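/- Let $\Omega=\{x\in\mathbb R^2:|x|<1\}$, with outward normal $n(x)=x$ on $\partial\Omega$, let $R_x=I-2\,n(x)\otimes n(x)$, let $Q$ be the counterclockwise rotation by $\pi/2$, and put $$\gamma_0=\{(x,v)\in\partial\Omega\times\mathbb R^2:v\cdot n(x)=0\},\qquad \gamma_-=\{(x,v)\in\partial\Omega\times\mathbb R^2:v\cdot n(x)<0\},\qquad \mathcal I=(\overline\Omega\times\mathbb R^2)\setminus\gamma_0 .$$ For $(x,v)\in\mathcal I$ let $t_{\mathbf b}(x,v)=\sup\{s\ge0:x-sv\in\Omega\}\in[0,\infty]$ (with $\sup\emptyset=0$) and $x_{\mathbf b}(x,v)=x-t_{\mathbf b}(x,v)v$ (for $v\ne0$). For $t\ge 0$ set $(t^0,x^0,v^0)=(t,x,v)$, $t^{k}=t^{k-1}-t_{\mathbf b}(x^{k-1},v^{k-1})$, $x^k=x_{\mathbf b}(x^{k-1},v^{k-1})$, $v^k=R_{x^k}v^{k-1}$, and for $s\in(t^{k+1},t^k]$ let $X(s;t,x,v)=x^k-(t^k-s)v^k$, $V(s;t,x,v)=v^k$ (for $v=0$: $X=x$, $V=0$).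 For $f_0:\overline\Omega\times\mathbb R^2\to\mathbb R$ define $$f(t,x,v)=f_0\big(X(0;t,x,v),V(0;t,x,v)\big),\qquad t\ge0,\ (x,v)\in\mathcal I .$$ Gradients are row vectors, $a\otimes b=ab^T$, $(\nabla_{xv}f_0)_{ij}=\partial_{x_j}\partial_{v_i}f_0$, $(\nabla_{vx}f_0)_{ij}=\partial_{v_j}\partial_{x_i}f_0$, and $N_{x,v}=\frac{(Qv)\otimes(Qv)}{v\cdot n(x)}$. Write $\langle v\rangle=1+|v|$, let $\|f_0\|_{C^k}\in[0,\infty]$ be the supremum over $\overline\Omega\times\mathbb R^2$ of the sum of the norms of the derivatives of order at most $k$ of $f_0$, and let $\|f(t,x,v)\|_{C^k_{t,x,v}}$ be the sum of the norms of the derivatives of order at most $k$ of $f$ at the point $(t,x,v)$. There are absolute constants $C_1,C_2>0$ for which the following holds. (1) Let $f_0\in C^1(\overline\Omega\times\mathbb R^2)$ satisfy $f_0(x,v)=f_0(x,R_xv)$ for $x\in\partial\Omega$, $v\in\mathbb R^2$, and, for all $(x,v)\in\gamma_-$, $$\big[\nabla_xf_0(x,v)+\nabla_vf_0(x,v)N_{x,v}\big]R_x=\nabla_xf_0(x,R_xv)+\nabla_vf_0(x,R_xv)N_{x,R_xv}.\tag{a}$$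 Then $f$ is a $C^1([0,\infty)\times\mathcal I)$ solution of $\partial_tf+v\cdot\nabla_xf=0$ in $\Omega$ with $f(t,x,v)=f(t,x,R_xv)$ for $(x,v)\in(\partial\Omega\times\mathbb R^2)\setminus\gamma_0$ and $f|_{t=0}=f_0$ on $\mathcal I$, and for all $t\ge0$ and $(x,v)\in\mathcal I$ with $v\neq0$ $$\|f(t,x,v)\|_{C^1_{t,x,v}}\le C_1\,\|f_0\|_{C^1}\,\frac{|v|}{|v\cdot n(x_{\mathbf b})|^{2}}\,\langle v\rangle^{2}(1+|v|t),\qquad x_{\mathbf b}=x_{\mathbf b}(x,v).$$ (2) Let $f_0\in C^2(\overline\Omega\times\mathbb R^2)$ satisfy $f_0(x,v)=f_0(x,R_xv)$ for $x\in\partial\Omega$, $v\in\mathbb R^2$, condition (a), and, for all $(x,v)\in\gamma_-$: $\nabla_xf_0(x,R_xv)$ and $\nabla_vf_0(x,R_xv)$ are scalar multiples of $(R_xv)^T$, $$R_x\big[\nabla_{xv}f_0(x,v)+\nabla_{vv}f_0(x,v)N_{x,v}\big]R_x=\nabla_{xv}f_0(x,R_xv)+\nabla_{vv}f_0(x,R_xv)N_{x,R_xv}+R_x\begin{bmatrix}\nabla_vf_0(x,R_xv)\mathcal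 J_1\\ \nabla_vf_0(x,R_xv)\mathcal J_2\end{bmatrix}R_x,$$ and $$\begin{aligned}&R_x\big[\nabla_{xx}f_0(x,v)+\nabla_{vx}f_0(x,v)N_{x,v}+N_{x,v}\nabla_{xv}f_0(x,v)\big]R_x\\&=\nabla_{xx}f_0(x,R_xv)+\nabla_{vx}f_0(x,R_xv)N_{x,R_xv}+N_{x,R_xv}\nabla_{xv}f_0(x,R_xv)-2R_x\begin{bmatrix}\nabla_vf_0(x,R_xv)\nabla_vA^1_{v,x}\\ \nabla_vf_0(x,R_xv)\nabla_vA^2_{v,x}\end{bmatrix}R_xA_{v,x}R_x\\&\quad+A_{v,x}\begin{bmatrix}\nabla_vf_0(x,R_xv)\mathcal J_1\\ \nabla_vf_0(x,R_xv)\mathcal J_2\end{bmatrix}R_x+R_x\begin{bmatrix}\nabla_vf_0(x,R_xv)\mathcal K_1\\ \nabla_vf_0(x,R_xv)\mathcal K_2\end{bmatrix}R_x.\end{aligned}$$ Here $A_{v,y}=\big((v\cdot n(y))I+n(y)\otimes v\big)\big(I-\frac{v\otimes n(y)}{v\cdot n(y)}\big)$, $A^i_{v,y}$ is its $i$-th column,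 $(\nabla_vA^i_{v,y})_{jk}=\partial_{v_k}(A_{v,y})_{ji}$ with $y$ fixed, and $$\mathcal J_1=\tfrac1{v\cdot x}\begin{bmatrix}-4v_2x_1x_2&4v_1x_1x_2\\-2v_2(x_2^2-x_1^2)&2v_1(x_2^2-x_1^2)\end{bmatrix},\qquad \mathcal J_2=\tfrac1{v\cdot x}\begin{bmatrix}-2v_2(x_2^2-x_1^2)&2v_1(x_2^2-x_1^2)\\4v_2x_1x_2&-4v_1x_1x_2\end{bmatrix},$$ $$\mathcal K_1=\tfrac{1}{(v\cdot x)^3}\begin{bmatrix}v_2^2\alpha&-v_1v_2\alpha\\ v_2^2\beta&-v_1v_2\beta\end{bmatrix},\qquad \mathcal K_2=\tfrac{1}{(v\cdot x)^3}\begin{bmatrix}-v_1v_2\alpha&v_1^2\alpha\\ -v_1v_2\beta&v_1^2\beta\end{bmatrix},$$ with $\alpha=4v_1^2x_1^3+2v_1v_2(3x_1^2x_2-x_2^3)+2v_2^2(3x_1x_2^2+x_1^3)$ and $\beta=4v_2^2x_2^3+2v_1v_2(3x_1x_2^2-x_1^3)+2v_1^2(3x_1^2x_2+x_2^3)$. Then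 $f$ is a $C^2([0,\infty)\times\mathcal I)$ solution of the same problem, and for all $t\ge0$ and $(x,v)\in\mathcal I$ with $v\ne0$ $$\|f(t,x,v)\|_{C^2_{t,x,v}}\le C_2\,\|f_0\|_{C^2}\,\frac{|v|^{2}}{|v\cdot n(x_{\mathbf b})|^{4}}\,\langle v\rangle^{4}(1+|v|t)^{2}.$$ -/

import Mathlib

open Set Matrix
open scoped ENNReal

noncomputable section

namespace DiskTransport

/-- The Euclidean plane. -/
abbrev Plane : Type := EuclideanSpace ℝ (Fin 2)

/-- The open unit disk `Ω`. -/
def disk : Set Plane := Metric.ball 0 1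

/-- The boundary `∂Ω`, the unit circle. -/
def circ : Set Plane := Metric.sphere 0 1

/-- The outward unit normal; for `x ∈ ∂Ω` it is `x` itself. -/
def normal (x : Plane) : Plane := x

/-- The reflection matrix `R_x = I - 2 n(x) ⊗ n(x)`. -/
def reflMat (x : Plane) : Matrix (Fin 2) (Fin 2) ℝ :=
  1 - (2 : ℝ) • vecMulVec (normal x).ofLp (normal x).ofLp

/-- The reflected velocity `R_x v`. -/
def refl (x v : Plane) : Plane := WithLp.toLp 2 (reflMat x *ᵥ v.ofLp)

/-- `Ω̄ × ℝ²`, where the initial datum lives. -/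
def dataDomain : Set (Plane × Plane) := closure disk ×ˢ univ

/-- The grazing set `γ₀`. -/
def grazing : Set (Plane × Plane) := {p | p.1 ∈ circ ∧ inner ℝ p.2 (normal p.1) = 0}

/-- The incoming set `γ₋`. -/
def incoming : Set (Plane × Plane) := {p | p.1 ∈ circ ∧ inner ℝ p.2 (normal p.1) < 0}

/-- The phase space `𝓘 = (Ω̄ × ℝ²) \ γ₀`. -/
def phaseSpace : Set (Plane × Plane) := dataDomain \ grazing

/-- `ℝ₊ × 𝓘`, with `ℝ₊ = [0, ∞)`. -/
def timePhase : Set (ℝ × Plane × Plane) := Ici 0 ×ˢ phaseSpace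

/-! ### Backward specular characteristics -/

/-- The backward exit time `t_b(x,v) = sup {s ≥ 0 : x - s v ∈ Ω}`. The supremum is taken in `[0, ∞]`:
it is `∞` if `v = 0` and `x ∈ Ω`, and it is `0` on the incoming set. -/
def exitTime (x v : Plane) : ℝ≥0∞ :=
  sSup (ENNReal.ofReal '' {s : ℝ | 0 ≤ s ∧ x - s • v ∈ disk})

/-- The backward exit point `x_b(x,v) = x - t_b(x,v) v`. -/
def exitPoint (x v : Plane) : Plane := x - (exitTime x v).toReal • v

/-- The backward bouncing points and velocities `(x^k, v^k)`, with `(x^0, v^0) = (x, v)`. -/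
def bounce (x v : Plane) : ℕ → Plane × Plane
  | 0 => (x, v)
  | k + 1 =>
      (exitPoint (bounce x v k).1 (bounce x v k).2,
        refl (exitPoint (bounce x v k).1 (bounce x v k).2) (bounce x v k).2)

/-- The backward bouncing times `t^k`, with `t^0 = t`. The value is `-∞` if there is no `k`-th
bounce. -/
def bounceTime (t : ℝ) (x v : Plane) : ℕ → EReal
  | 0 => (t : EReal)
  | k + 1 => bounceTime t x v k - (exitTime (bounce x v k).1 (bounce x v k).2 : EReal)

/-- The set of times `s ∈ (t^{k+1}, t^k]`. -/
def flight (t : ℝ) (x v : Plane) (k : ℕ) : Set ℝ :=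
  {s | bounceTime t x v (k + 1) < (s : EReal) ∧ (s : EReal) ≤ bounceTime t x v k}

/-- The position `X(s;t,x,v)`. -/
def charX (s t : ℝ) (x v : Plane) : Plane :=
  ∑ᶠ k : ℕ, (flight t x v k).indicator
    (fun s => (bounce x v k).1 - ((bounceTime t x v k).toReal - s) • (bounce x v k).2) s

/-- The velocity `V(s;t,x,v)`. -/
def charV (s t : ℝ) (x v : Plane) : Plane :=
  ∑ᶠ k : ℕ, (flight t x v k).indicator (fun _ => (bounce x v k).2) s

/-- The mild solution `f(t,x,v) = f₀(X(0;t,x,v), V(0;t,x,v))`. -/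
def mildSol (f₀ : Plane × Plane → ℝ) : ℝ × Plane × Plane → ℝ :=
  fun p => f₀ (charX 0 p.1 p.2.1 p.2.2, charV 0 p.1 p.2.1 p.2.2)

/-- `f` is a classical `C^k` solution on `ℝ₊ × 𝓘` of `∂_t f + v · ∇_x f = 0` in the disk, with
specular reflection at the boundary and with initial datum `f₀`. -/
structure IsClassicalSol (k : ℕ) (f₀ : Plane × Plane → ℝ) (f : ℝ × Plane × Plane → ℝ) : Prop where
  contDiffOn : ContDiffOn ℝ k f timePhase
  transport : ∀ t : ℝ, 0 ≤ t → ∀ x ∈ disk, ∀ v : Plane,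
    fderivWithin ℝ f timePhase (t, x, v) (1, v, 0) = 0
  specular : ∀ t : ℝ, 0 ≤ t → ∀ x ∈ circ, ∀ v : Plane, (x, v) ∉ grazing →
    f (t, x, v) = f (t, x, refl x v)
  initial : ∀ p ∈ phaseSpace, f (0, p) = f₀ p

/-! ### `C^k` norms -/

section norms

variable {E : Type*} [NormedAddCommGroup E] [NormedSpace ℝ E]

/-- The sum of the norms at `p` of all derivatives of order at most `k` of `g`, taken within `S`. -/
def jetNorm (k : ℕ) (g : E → ℝ) (S : Set E) (p : E) : ℝ≥0∞ :=
  ∑ j ∈ Finset.range (k + 1), ‖iteratedFDerivWithin ℝ j g S p‖ₑ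

/-- The `C^k(S)` norm (possibly infinite). -/
def cNorm (k : ℕ) (g : E → ℝ) (S : Set E) : ℝ≥0∞ := ⨆ p ∈ S, jetNorm k g S p

end norms

/-! ### Derivatives of the initial datum -/

/-- `∂_{x_j} g` on `Ω̄ × ℝ²`. -/
def dX (j : Fin 2) (g : Plane × Plane → ℝ) : Plane × Plane → ℝ :=
  fun p => fderivWithin ℝ g dataDomain p (EuclideanSpace.single j 1, 0)

/-- `∂_{v_j} g` on `Ω̄ × ℝ²`. -/
def dV (j : Fin 2) (g : Plane × Plane → ℝ) : Plane × Plane → ℝ :=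
  fun p => fderivWithin ℝ g dataDomain p (0, EuclideanSpace.single j 1)

/-- The row vector `∇_x g`. -/
def gradX (g : Plane × Plane → ℝ) (x v : Plane) : Fin 2 → ℝ := fun i => dX i g (x, v)

/-- The row vector `∇_v g`. -/
def gradV (g : Plane × Plane → ℝ) (x v : Plane) : Fin 2 → ℝ := fun i => dV i g (x, v)

/-- `∇_{xx} g`, with entries `∂_{x_j} ∂_{x_i} g`. -/
def hessXX (g : Plane × Plane → ℝ) (x v : Plane) : Matrix (Fin 2) (Fin 2) ℝ :=
  Matrix.of fun i j => dX j (dX i g) (x, v)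

/-- `∇_{xv} g = ∇_x (∇_v g)`, with entries `∂_{x_j} ∂_{v_i} g`. -/
def hessXV (g : Plane × Plane → ℝ) (x v : Plane) : Matrix (Fin 2) (Fin 2) ℝ :=
  Matrix.of fun i j => dX j (dV i g) (x, v)

/-- `∇_{vx} g = ∇_v (∇_x g)`, with entries `∂_{v_j} ∂_{x_i} g`. -/
def hessVX (g : Plane × Plane → ℝ) (x v : Plane) : Matrix (Fin 2) (Fin 2) ℝ :=
  Matrix.of fun i j => dV j (dX i g) (x, v)

/-- `∇_{vv} g`, with entries `∂_{v_j} ∂_{v_i} g`. -/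
def hessVV (g : Plane × Plane → ℝ) (x v : Plane) : Matrix (Fin 2) (Fin 2) ℝ :=
  Matrix.of fun i j => dV j (dV i g) (x, v)

/-! ### Matrices in the compatibility conditions -/

/-- Counterclockwise rotation by `π / 2`. -/
def rotQ : Matrix (Fin 2) (Fin 2) ℝ := !![0, -1; 1, 0]

/-- `(Qv) ⊗ (Qv) / (v · n(x))`. -/
def rotTensor (x v : Plane) : Matrix (Fin 2) (Fin 2) ℝ :=
  (inner ℝ v (normal x))⁻¹ • vecMulVec (rotQ *ᵥ v.ofLp) (rotQ *ᵥ v.ofLp)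

/-- `A_{v,y} = ((v · n(y)) I + n(y) ⊗ v) (I - v ⊗ n(y) / (v · n(y)))`. -/
def matA (v y : Plane) : Matrix (Fin 2) (Fin 2) ℝ :=
  (inner ℝ v (normal y) • (1 : Matrix (Fin 2) (Fin 2) ℝ) + vecMulVec (normal y).ofLp v.ofLp) *
    (1 - (inner ℝ v (normal y))⁻¹ • vecMulVec v.ofLp (normal y).ofLp)

/-- `∇_v A^i_{v,y}`, the derivative in `v` (with `y` fixed) of the `i`-th column of `A_{v,y}`;
its entries are `∂_{v_k} (A_{v,y})_{ji}`. -/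
def gradA (v y : Plane) (i : Fin 2) : Matrix (Fin 2) (Fin 2) ℝ :=
  Matrix.of fun j k => fderiv ℝ (fun w : Plane => matA w y j i) v (EuclideanSpace.single k 1)

/-- The matrices `𝒥₁, 𝒥₂`. -/
def matJ (x v : Plane) : Fin 2 → Matrix (Fin 2) (Fin 2) ℝ :=
  ![(inner ℝ v x)⁻¹ •
      !![-4 * v 1 * x 0 * x 1, 4 * v 0 * x 0 * x 1;
         -2 * v 1 * (x 1 ^ 2 - x 0 ^ 2), 2 * v 0 * (x 1 ^ 2 - x 0 ^ 2)],
    (inner ℝ v x)⁻¹ •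
      !![-2 * v 1 * (x 1 ^ 2 - x 0 ^ 2), 2 * v 0 * (x 1 ^ 2 - x 0 ^ 2);
         4 * v 1 * x 0 * x 1, -4 * v 0 * x 0 * x 1]]

/-- The matrices `𝒦₁, 𝒦₂`. -/
def matK (x v : Plane) : Fin 2 → Matrix (Fin 2) (Fin 2) ℝ :=
  ![((inner ℝ v x) ^ 3)⁻¹ •
      !![4 * v 0 ^ 2 * v 1 ^ 2 * x 0 ^ 3 + 2 * v 0 * v 1 ^ 3 * (3 * x 0 ^ 2 * x 1 - x 1 ^ 3)
            + 2 * v 1 ^ 4 * (3 * x 0 * x 1 ^ 2 + x 0 ^ 3),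
          -4 * v 0 ^ 3 * v 1 * x 0 ^ 3 - 2 * v 0 ^ 2 * v 1 ^ 2 * (3 * x 0 ^ 2 * x 1 - x 1 ^ 3)
            - 2 * v 0 * v 1 ^ 3 * (3 * x 0 * x 1 ^ 2 + x 0 ^ 3);
         4 * v 1 ^ 4 * x 1 ^ 3 + 2 * v 0 * v 1 ^ 3 * (3 * x 0 * x 1 ^ 2 - x 0 ^ 3)
            + 2 * v 0 ^ 2 * v 1 ^ 2 * (3 * x 0 ^ 2 * x 1 + x 1 ^ 3),
          -4 * v 0 * v 1 ^ 3 * x 1 ^ 3 - 2 * v 0 ^ 2 * v 1 ^ 2 * (3 * x 0 * x 1 ^ 2 - x 0 ^ 3)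
            - 2 * v 0 ^ 3 * v 1 * (3 * x 0 ^ 2 * x 1 + x 1 ^ 3)],
    ((inner ℝ v x) ^ 3)⁻¹ •
      !![-4 * v 0 ^ 3 * v 1 * x 0 ^ 3 - 2 * v 0 * v 1 ^ 3 * (3 * x 0 * x 1 ^ 2 + x 0 ^ 3)
            - 2 * v 0 ^ 2 * v 1 ^ 2 * (3 * x 0 ^ 2 * x 1 - x 1 ^ 3),
          4 * v 0 ^ 4 * x 0 ^ 3 + 2 * v 0 ^ 2 * v 1 ^ 2 * (3 * x 0 * x 1 ^ 2 + x 0 ^ 3)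
            + 2 * v 0 ^ 3 * v 1 * (3 * x 0 ^ 2 * x 1 - x 1 ^ 3);
         -4 * v 0 * v 1 ^ 3 * x 1 ^ 3 - 2 * v 0 ^ 3 * v 1 * (3 * x 0 ^ 2 * x 1 + x 1 ^ 3)
            - 2 * v 0 ^ 2 * v 1 ^ 2 * (3 * x 0 * x 1 ^ 2 - x 0 ^ 3),
          4 * v 0 ^ 2 * v 1 ^ 2 * x 1 ^ 3 + 2 * v 0 ^ 4 * (3 * x 0 ^ 2 * x 1 + x 1 ^ 3)
            + 2 * v 0 ^ 3 * v 1 * (3 * x 0 * x 1 ^ 2 - x 0 ^ 3)]]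

/-- The matrix with rows `g M₁` and `g M₂`. -/
def stack (g : Fin 2 → ℝ) (M : Fin 2 → Matrix (Fin 2) (Fin 2) ℝ) : Matrix (Fin 2) (Fin 2) ℝ :=
  Matrix.of fun i => g ᵥ* M i

/-! ### Hypotheses on the initial datum -/

/-- Specular reflection of the initial datum. -/
def SpecularData (f₀ : Plane × Plane → ℝ) : Prop :=
  ∀ x ∈ circ, ∀ v : Plane, f₀ (x, v) = f₀ (x, refl x v)

/-- The first order initial-boundary compatibility condition on `γ₋`. -/
def CompatC1 (f₀ : Plane × Plane → ℝ) : Prop :=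
  ∀ x v : Plane, (x, v) ∈ incoming →
    (gradX f₀ x v + gradV f₀ x v ᵥ* rotTensor x v) ᵥ* reflMat x =
      gradX f₀ x (refl x v) + gradV f₀ x (refl x v) ᵥ* rotTensor x (refl x v)

/-- `∇_x f₀(x, R_x v)` and `∇_v f₀(x, R_x v)` are parallel to `R_x v`, on `γ₋`. -/
def CompatParallel (f₀ : Plane × Plane → ℝ) : Prop :=
  ∀ x v : Plane, (x, v) ∈ incoming →
    (∃ c : ℝ, gradX f₀ x (refl x v) = c • (refl x v).ofLp) ∧
      ∃ c : ℝ, gradV f₀ x (refl x v) = c • (refl x v).ofLp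

/-- The second order compatibility condition for the mixed derivatives on `γ₋`. -/
def CompatXV (f₀ : Plane × Plane → ℝ) : Prop :=
  ∀ x v : Plane, (x, v) ∈ incoming →
    reflMat x * (hessXV f₀ x v + hessVV f₀ x v * rotTensor x v) * reflMat x =
      hessXV f₀ x (refl x v) + hessVV f₀ x (refl x v) * rotTensor x (refl x v)
        + reflMat x * stack (gradV f₀ x (refl x v)) (matJ x v) * reflMat x

/-- The second order compatibility condition for the spatial derivatives on `γ₋`. The matrices
`𝒦ᵢ` are the `x`-derivatives of the columns of `-2 A_{v,x_b(x,v)}`; they enter with factor `1`. -/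
def CompatXX (f₀ : Plane × Plane → ℝ) : Prop :=
  ∀ x v : Plane, (x, v) ∈ incoming →
    reflMat x * (hessXX f₀ x v + hessVX f₀ x v * rotTensor x v
        + rotTensor x v * hessXV f₀ x v) * reflMat x =
      hessXX f₀ x (refl x v) + hessVX f₀ x (refl x v) * rotTensor x (refl x v)
        + rotTensor x (refl x v) * hessXV f₀ x (refl x v)
        - (2 : ℝ) • (reflMat x * stack (gradV f₀ x (refl x v)) (gradA v x)
            * reflMat x * matA v x * reflMat x)
        + matA v x * stack (gradV f₀ x (refl x v)) (matJ x v) * reflMat x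
        + reflMat x * stack (gradV f₀ x (refl x v)) (matK x v) * reflMat x

/-- Initial data for `C¹` solutions. -/
structure AdmissibleC1 (f₀ : Plane × Plane → ℝ) : Prop where
  contDiffOn : ContDiffOn ℝ 1 f₀ dataDomain
  specular : SpecularData f₀
  compat : CompatC1 f₀

/-- Initial data for `C²` solutions. -/
structure AdmissibleC2 (f₀ : Plane × Plane → ℝ) : Prop where
  contDiffOn : ContDiffOn ℝ 2 f₀ dataDomain
  specular : SpecularData f₀
  compat : CompatC1 f₀
  parallel : CompatParallel f₀
  compatXV : CompatXV f₀
  compatXX : CompatXX f₀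

/-- `⟨v⟩ = 1 + |v|`. -/
def japanese (v : Plane) : ℝ := 1 + ‖v‖

/-- The quantity `|v · n(x_b(x,v))|`. -/
def hitSpeed (x v : Plane) : ℝ := |inner ℝ v (normal (exitPoint x v))|

end DiskTransport

end

noncomputable section

namespace DiskTransport

/-! ### Plane geometry -/

/-! Specular motion in a disk is integrable, so the reflections can be unfolded. On a line meeting
the disk, the signed distance `impact` from the origin is conserved, and every backward reflection
amounts to a translation by the chord length `2 * halfChord` along the line followed by a rotation
by `deflection`. Thus `billiard` is a smooth action of ℤ on `chordSet` that commutes with free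
motion. Transporting the datum by this action gives an invariant function `unfolded f₀`, and
`mildSol_eq_unfolded` identifies the solution with `unfolded f₀ (x - t v, v)`. The transport
equation, the boundary condition and the initial condition follow from this formula, so regularity
is a question about `unfolded f₀` alone.

By invariance, regularity is needed only near the incoming boundary (and at interior points with `v
= 0`). There `unfolded f₀` is `f₀` on one side and `f₀ ∘ billiard 1` on the other. The two pieces
agree on the boundary, hence so do their derivatives in tangential directions; only the transversal
direction `(v, 0)` of the free flow remains (`fderiv_eq_on_exit`). Condition (a) paired with `R_x v`
says that `v · ∇_x f₀` is preserved by reflection, which gives C¹. For C², symmetry of second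
derivatives reduces the matching to the gradient of `v · ∇_x f₀`, whose transversal part is the
quadratic form of `∇_{xx} f₀` at `v`. The condition on `∇_{xx}` contracted with `R_x v` on both
sides matches it, as all correction matrices annihilate `v` or `R_x v`.

For the bounds, the solution is locally `unfolded f₀ ∘ rewind k` with `k * halfChord ≤ 1 + |v| t`.
Each derivative of `halfChord` or `arcsin` of `impact` costs powers of `1 / halfChord`, and the
count of bounces costs one more. Since the final position lies in the disk, differentiating the
rotation costs no further factor. The result (`jetBound_rewind`) is `growth * (1 + |v|)`, which
equals the weight in the theorem because `|v · n(x_b)| = |v| * halfChord`. -/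

lemma plane_inner (x y : Plane) : inner ℝ x y = x 0 * y 0 + x 1 * y 1 := by
  simp [PiLp.inner_apply, Fin.sum_univ_two, mul_comm]

lemma plane_norm_sq (x : Plane) : ‖x‖ ^ 2 = x 0 ^ 2 + x 1 ^ 2 := by
  rw [← real_inner_self_eq_norm_sq, plane_inner]; ring

/-- Rotation by `π / 2`. -/
def perp : Plane →L[ℝ] Plane :=
  LinearMap.toContinuousLinearMap
    { toFun := fun v => !₂[-v 1, v 0]
      map_add' := by
        intro v w; ext i; fin_cases i <;> simp; ring
      map_smul' := by
        intro c v; ext i; fin_cases i <;> simp }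

@[simp] lemma perp_zero_coord (v : Plane) : perp v 0 = -v 1 := rfl

@[simp] lemma perp_one_coord (v : Plane) : perp v 1 = v 0 := rfl

lemma plane_ext {x y : Plane} (h0 : x 0 = y 0) (h1 : x 1 = y 1) : x = y := by
  ext i; fin_cases i <;> assumption

/-- Rotation by the angle `θ`. -/
def rot (θ : ℝ) : Plane →L[ℝ] Plane :=
  Real.cos θ • ContinuousLinearMap.id ℝ Plane + Real.sin θ • perp

lemma rot_apply (θ : ℝ) (v : Plane) : rot θ v = Real.cos θ • v + Real.sin θ • perp v := rfl

lemma rot_zero_coord (θ : ℝ) (v : Plane) :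
    rot θ v 0 = Real.cos θ * v 0 - Real.sin θ * v 1 := by
  simp [rot_apply]; ring

lemma rot_one_coord (θ : ℝ) (v : Plane) :
    rot θ v 1 = Real.cos θ * v 1 + Real.sin θ * v 0 := by
  simp [rot_apply]

@[simp] lemma rot_zero : rot 0 = ContinuousLinearMap.id ℝ Plane := by
  ext v : 1; simp [rot_apply]

lemma rot_add (θ η : ℝ) (v : Plane) : rot (θ + η) v = rot θ (rot η v) := by
  apply plane_ext <;>
    simp only [rot_zero_coord, rot_one_coord, Real.cos_add, Real.sin_add] <;> ring

lemma inner_rot_rot (θ : ℝ) (v w : Plane) : inner ℝ (rot θ v) (rot θ w) = inner ℝ v w := by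
  simp only [plane_inner, rot_zero_coord, rot_one_coord]
  linear_combination (v 0 * w 0 + v 1 * w 1) * Real.sin_sq_add_cos_sq θ

lemma perp_rot (θ : ℝ) (v : Plane) : perp (rot θ v) = rot θ (perp v) := by
  apply plane_ext <;> simp only [rot_zero_coord, rot_one_coord, perp_zero_coord, perp_one_coord] <;>
    ring

@[simp] lemma norm_rot (θ : ℝ) (v : Plane) : ‖rot θ v‖ = ‖v‖ := by
  rw [← sq_eq_sq₀ (norm_nonneg _) (norm_nonneg _), ← real_inner_self_eq_norm_sq, inner_rot_rot,
    real_inner_self_eq_norm_sq]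

@[simp] lemma norm_perp (v : Plane) : ‖perp v‖ = ‖v‖ := by
  rw [← sq_eq_sq₀ (norm_nonneg _) (norm_nonneg _), plane_norm_sq, plane_norm_sq]; simp; ring

@[simp] lemma inner_perp_self (v : Plane) : inner ℝ v (perp v) = (0 : ℝ) := by
  simp [plane_inner]; ring

lemma norm_sq_smul_decomp (y v : Plane) :
    ‖v‖ ^ 2 • y = (inner ℝ y v : ℝ) • v + (inner ℝ y (perp v) : ℝ) • perp v := by
  apply plane_ext <;> simp [plane_inner, plane_norm_sq] <;> ring

lemma inner_sq_add_inner_perp_sq (y v : Plane) :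
    (inner ℝ y v : ℝ) ^ 2 + (inner ℝ y (perp v) : ℝ) ^ 2 = ‖y‖ ^ 2 * ‖v‖ ^ 2 := by
  simp [plane_inner, plane_norm_sq]; ring

lemma refl_eq (x v : Plane) : refl x v = v - (2 * inner ℝ x v : ℝ) • x := by
  apply plane_ext <;>
    simp [refl, reflMat, normal, plane_inner, vecMulVec_apply] <;> ring

lemma inner_refl {x : Plane} (hx : ‖x‖ = 1) (v : Plane) :
    inner ℝ x (refl x v) = -(inner ℝ x v : ℝ) := by
  have h : (inner ℝ x x : ℝ) = 1 := by rw [real_inner_self_eq_norm_sq, hx]; norm_num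
  rw [refl_eq, inner_sub_right, inner_smul_right, h]; ring

lemma refl_refl {x : Plane} (hx : ‖x‖ = 1) (v : Plane) : refl x (refl x v) = v := by
  rw [refl_eq x (refl x v), inner_refl hx, refl_eq]; module

/-! ### Chord coordinates -/

/-- The signed distance of the line through `q.1` with direction `q.2` from the origin. -/
def impact (q : Plane × Plane) : ℝ := inner ℝ q.1 (perp q.2) / ‖q.2‖

/-- The coordinate of `q.1` along the direction of `q.2`. -/
def along (q : Plane × Plane) : ℝ := inner ℝ q.1 q.2 / ‖q.2‖

/-- Half the length of the chord cut out by the disk on the line through `q.1` along `q.2`. -/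
def halfChord (q : Plane × Plane) : ℝ := √(1 - impact q ^ 2)

/-- The angle by which a backward specular reflection turns the velocity. -/
def deflection (q : Plane × Plane) : ℝ := Real.pi - 2 * Real.arcsin (impact q)

/-- The `k`-fold backward reflection of the straight line motion. -/
def billiard (k : ℤ) (q : Plane × Plane) : Plane × Plane :=
  (rot (k * deflection q) (q.1 + (2 * k * halfChord q / ‖q.2‖) • q.2),
    rot (k * deflection q) q.2)

/-- The lines meeting the open disk, with nonzero velocity. -/
def chordSet : Set (Plane × Plane) := {q | q.2 ≠ 0 ∧ |impact q| < 1}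

lemma halfChord_pos {q : Plane × Plane} (hq : q ∈ chordSet) : 0 < halfChord q := by
  have := (sq_lt_one_iff_abs_lt_one (impact q)).2 hq.2
  exact Real.sqrt_pos.2 (by linarith)

lemma halfChord_sq {q : Plane × Plane} (hq : q ∈ chordSet) :
    halfChord q ^ 2 = 1 - impact q ^ 2 := by
  have := (sq_lt_one_iff_abs_lt_one (impact q)).2 hq.2
  exact Real.sq_sqrt (by linarith)

lemma halfChord_le_one (q : Plane × Plane) : halfChord q ≤ 1 := by
  rw [halfChord, Real.sqrt_le_iff]
  exact ⟨zero_le_one, by nlinarith [sq_nonneg (impact q)]⟩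

lemma norm_fst_sq {q : Plane × Plane} (hq : q.2 ≠ 0) :
    ‖q.1‖ ^ 2 = along q ^ 2 + impact q ^ 2 := by
  have h := inner_sq_add_inner_perp_sq q.1 q.2
  have hv : ‖q.2‖ ≠ 0 := norm_ne_zero_iff.2 hq
  rw [along, impact]; field_simp; linarith

/-- On a fixed line, lying in the disk is a condition on `along` alone; the dynamics thereby becomes
one dimensional. -/
lemma norm_fst_le_one_iff {q : Plane × Plane} (hq : q ∈ chordSet) :
    ‖q.1‖ ≤ 1 ↔ |along q| ≤ halfChord q := by
  rw [← abs_of_pos (halfChord_pos hq), ← sq_le_sq, halfChord_sq hq,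
    ← sq_le_one_iff₀ (norm_nonneg _), norm_fst_sq hq.1]
  constructor <;> intro h <;> linarith

lemma norm_fst_lt_one_iff {q : Plane × Plane} (hq : q ∈ chordSet) :
    ‖q.1‖ < 1 ↔ |along q| < halfChord q := by
  rw [← abs_of_pos (halfChord_pos hq), ← sq_lt_sq, halfChord_sq hq,
    ← sq_lt_one_iff₀ (norm_nonneg _), norm_fst_sq hq.1]
  constructor <;> intro h <;> linarith

lemma fst_decomp {q : Plane × Plane} (hq : q.2 ≠ 0) :
    q.1 = (along q / ‖q.2‖) • q.2 + (impact q / ‖q.2‖) • perp q.2 := by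
  have h := norm_sq_smul_decomp q.1 q.2
  have hv : ‖q.2‖ ≠ 0 := norm_ne_zero_iff.2 hq
  rw [along, impact]
  calc q.1 = (‖q.2‖ ^ 2)⁻¹ • ‖q.2‖ ^ 2 • q.1 := by
        rw [smul_smul, inv_mul_cancel₀ (pow_ne_zero 2 hv), one_smul]
    _ = _ := by rw [h, smul_add, smul_smul, smul_smul]; congr 2 <;> field_simp

/-! ### Invariance under free motion and rotations -/

lemma impact_shift (y v : Plane) (c : ℝ) : impact (y + c • v, v) = impact (y, v) := by
  simp [impact, inner_add_left, inner_smul_left]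

lemma along_shift (y : Plane) {v : Plane} (hv : v ≠ 0) (c : ℝ) :
    along (y + c • v, v) = along (y, v) + c * ‖v‖ := by
  have hv : ‖v‖ ≠ 0 := norm_ne_zero_iff.2 hv
  simp only [along, inner_add_left, inner_smul_left, real_inner_self_eq_norm_sq]
  simp; field_simp

lemma impact_rot (θ : ℝ) (y v : Plane) : impact (rot θ y, rot θ v) = impact (y, v) := by
  simp [impact, perp_rot, inner_rot_rot]

lemma along_rot (θ : ℝ) (y v : Plane) : along (rot θ y, rot θ v) = along (y, v) := by
  simp [along, inner_rot_rot]

@[simp] lemma impact_billiard (k : ℤ) (q : Plane × Plane) :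
    impact (billiard k q) = impact q := by
  rw [billiard, impact_rot, impact_shift]

@[simp] lemma halfChord_billiard (k : ℤ) (q : Plane × Plane) :
    halfChord (billiard k q) = halfChord q := by
  simp [halfChord]

@[simp] lemma deflection_billiard (k : ℤ) (q : Plane × Plane) :
    deflection (billiard k q) = deflection q := by
  simp [deflection]

lemma along_billiard (k : ℤ) {q : Plane × Plane} (hq : q.2 ≠ 0) :
    along (billiard k q) = along q + 2 * k * halfChord q := by
  rw [billiard, along_rot, along_shift _ hq, div_mul_cancel₀ _ (norm_ne_zero_iff.2 hq)]

@[simp] lemma norm_billiard_snd (k : ℤ) (q : Plane × Plane) : ‖(billiard k q).2‖ = ‖q.2‖ := by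
  simp [billiard]

lemma billiard_mem_chordSet (k : ℤ) {q : Plane × Plane} (hq : q ∈ chordSet) :
    billiard k q ∈ chordSet := by
  refine ⟨?_, by simpa using hq.2⟩
  rw [← norm_ne_zero_iff, norm_billiard_snd, norm_ne_zero_iff]; exact hq.1

@[simp] lemma billiard_zero (q : Plane × Plane) : billiard 0 q = q := by
  simp [billiard]

/-- `halfChord`, `deflection` and the speed are constant on orbits, so the angles and the
displacements simply add up. -/
lemma billiard_add (j k : ℤ) (q : Plane × Plane) :
    billiard (j + k) q = billiard j (billiard k q) := by
  have h : ((j + k : ℤ) : ℝ) * deflection q = j * deflection q + k * deflection q := by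
    push_cast; ring
  rw [billiard.eq_1 (j + k), billiard.eq_1 j, halfChord_billiard, deflection_billiard,
    norm_billiard_snd, h]
  simp only [rot_add, billiard]
  rw [← map_smul, ← map_add, add_assoc, ← add_smul]
  congr 5
  push_cast; ring

/-- Sliding along the line changes neither the chord nor the angle, so reflections commute with free
motion. -/
lemma billiard_shift (k : ℤ) (y v : Plane) (c : ℝ) :
    billiard k (y + c • v, v) = ((billiard k (y, v)).1 + c • (billiard k (y, v)).2,
      (billiard k (y, v)).2) := by
  simp only [billiard, halfChord, deflection, impact_shift]
  rw [← map_smul, ← map_add]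
  congr 2
  module

lemma cos_deflection {q : Plane × Plane} (hq : q ∈ chordSet) :
    Real.cos (deflection q) = 2 * impact q ^ 2 - 1 := by
  have h := abs_lt.1 hq.2
  rw [deflection, Real.cos_pi_sub, Real.cos_two_mul, Real.cos_sq',
    Real.sin_arcsin h.1.le h.2.le]
  ring

lemma sin_deflection {q : Plane × Plane} (hq : q ∈ chordSet) :
    Real.sin (deflection q) = 2 * impact q * halfChord q := by
  have h := abs_lt.1 hq.2
  rw [deflection, Real.sin_pi_sub, Real.sin_two_mul,
    Real.sin_arcsin h.1.le h.2.le, Real.cos_arcsin, halfChord]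

/-- On the incoming boundary, the backward reflection is the specular reflection. -/
lemma billiard_one_of_along {q : Plane × Plane} (hq : q ∈ chordSet)
    (hs : along q = -halfChord q) : billiard 1 q = (q.1, refl q.1 q.2) := by
  have hv : ‖q.2‖ ≠ 0 := norm_ne_zero_iff.2 hq.1
  have hd := fst_decomp hq.1
  have hσ := halfChord_sq hq
  have hi : inner ℝ q.1 q.2 = -halfChord q * ‖q.2‖ := by
    rw [← hs, along, div_mul_cancel₀ _ hv]
  have hpp : perp (perp q.2) = -q.2 := by apply plane_ext <;> simp
  rw [billiard, refl_eq, hi]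
  simp only [Int.cast_one, one_mul, mul_one, rot_apply, cos_deflection hq, sin_deflection hq]
  rw [hs] at hd
  set b := impact q
  set σ := halfChord q
  set ρ := ‖q.2‖
  set v := q.2
  rw [hd]
  simp only [map_add, map_smul, hpp]
  -- In the frame `v`, `perp v` both components reduce to scalar identities modulo `σ ^ 2 = 1 - b ^
  -- 2`: the point slides to the far end of the chord and is rotated back to where it was.
  refine Prod.ext ?_ ?_
  · simp only
    match_scalars
    · field_simp; ring
    · field_simp; linear_combination (2 * b : ℝ) * hσ
  · simp only
    match_scalars
    · field_simp; linear_combination (2:ℝ) * hσ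
    · field_simp

/-! ### Smoothness of the chord coordinates -/

section smooth

variable {n : WithTop ℕ∞} {q : Plane × Plane}

lemma contDiffAt_norm_snd (hq : q.2 ≠ 0) :
    ContDiffAt ℝ n (fun q : Plane × Plane => ‖q.2‖) q :=
  contDiffAt_snd.norm ℝ hq

lemma contDiffAt_impact (hq : q.2 ≠ 0) : ContDiffAt ℝ n impact q :=
  (contDiffAt_fst.inner ℝ (perp.contDiff.contDiffAt.comp q contDiffAt_snd)).div
    (contDiffAt_norm_snd hq) (norm_ne_zero_iff.2 hq)

lemma contDiffAt_along (hq : q.2 ≠ 0) : ContDiffAt ℝ n along q :=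
  (contDiffAt_fst.inner ℝ contDiffAt_snd).div
    (contDiffAt_norm_snd hq) (norm_ne_zero_iff.2 hq)

lemma contDiffAt_halfChord (hq : q ∈ chordSet) : ContDiffAt ℝ n halfChord q := by
  have h := (sq_lt_one_iff_abs_lt_one (impact q)).2 hq.2
  exact (contDiffAt_const.sub ((contDiffAt_impact hq.1).pow 2)).sqrt
    (by simp only [ne_eq]; linarith)

lemma contDiffAt_deflection (hq : q ∈ chordSet) : ContDiffAt ℝ n deflection q := by
  have h := abs_lt.1 hq.2
  exact contDiffAt_const.sub (contDiffAt_const.mul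
    ((Real.contDiffAt_arcsin h.1.ne' h.2.ne).comp q (contDiffAt_impact hq.1)))

lemma contDiffAt_billiard (k : ℤ) (hq : q ∈ chordSet) : ContDiffAt ℝ n (billiard k) q := by
  have hθ : ContDiffAt ℝ n (fun q => k * deflection q) q :=
    contDiffAt_const.mul (contDiffAt_deflection hq)
  have hrot : ∀ {g : Plane × Plane → Plane}, ContDiffAt ℝ n g q →
      ContDiffAt ℝ n (fun q => rot (k * deflection q) (g q)) q := by
    intro g hg
    simp only [rot_apply]
    exact (hθ.cos.smul hg).add (hθ.sin.smul (perp.contDiff.contDiffAt.comp q hg))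
  have hc : ContDiffAt ℝ n (fun q : Plane × Plane => 2 * k * halfChord q / ‖q.2‖) q :=
    (contDiffAt_const.mul (contDiffAt_halfChord hq)).div (contDiffAt_norm_snd hq.1)
      (norm_ne_zero_iff.2 hq.1)
  have h1 := hrot (contDiffAt_fst.add (hc.smul contDiffAt_snd))
  have h2 := hrot contDiffAt_snd
  exact h1.prodMk h2

lemma isOpen_chordSet : IsOpen chordSet := by
  rw [isOpen_iff_mem_nhds]
  intro q hq
  have h1 : ∀ᶠ p : Plane × Plane in nhds q, p.2 ≠ 0 :=
    continuous_snd.continuousAt.eventually_ne hq.1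
  have h2 : ∀ᶠ p : Plane × Plane in nhds q, |impact p| < 1 :=
    (contDiffAt_impact (n := 0) hq.1).continuousAt.abs.eventually_lt continuousAt_const hq.2
  filter_upwards [h1, h2] with p hp1 hp2 using ⟨hp1, hp2⟩

end smooth

/-! ### The phase space -/

lemma mem_dataDomain_iff {q : Plane × Plane} : q ∈ dataDomain ↔ ‖q.1‖ ≤ 1 := by
  simp [dataDomain, disk, closure_ball]

lemma mem_circ_iff {x : Plane} : x ∈ circ ↔ ‖x‖ = 1 := by simp [circ]

lemma mem_disk_iff {x : Plane} : x ∈ disk ↔ ‖x‖ < 1 := by simp [disk]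

/-- By Pythagoras, a point of the closed disk with `|impact| ≥ 1` has `along = 0` and norm one,
which is exactly grazing. Off the grazing set `halfChord` is therefore positive. -/
lemma mem_chordSet_of_mem_phaseSpace {x v : Plane} (h : (x, v) ∈ phaseSpace) (hv : v ≠ 0) :
    (x, v) ∈ chordSet := by
  refine ⟨hv, ?_⟩
  have hx : ‖x‖ ≤ 1 := (mem_dataDomain_iff (q := (x, v))).1 h.1
  have h1 : ‖x‖ ^ 2 = along (x, v) ^ 2 + impact (x, v) ^ 2 := norm_fst_sq (q := (x, v)) hv
  have h2 : ‖x‖ ^ 2 ≤ 1 := by nlinarith [norm_nonneg x]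
  rw [← sq_lt_one_iff_abs_lt_one]
  by_contra hb
  have ha : along (x, v) = 0 := by
    have : along (x, v) ^ 2 ≤ 0 := by linarith
    exact pow_eq_zero_iff two_ne_zero |>.1 (le_antisymm this (sq_nonneg _))
  refine h.2 ⟨mem_circ_iff.2 ?_, ?_⟩
  · show ‖x‖ = 1
    nlinarith [sq_nonneg (along (x, v)), norm_nonneg x]
  · have hvn : ‖v‖ ≠ 0 := norm_ne_zero_iff.2 hv
    rw [along, div_eq_zero_iff] at ha
    rw [real_inner_comm]
    exact ha.resolve_right hvn

/-- A boundary point with zero velocity counts as grazing. -/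
lemma norm_lt_one_of_mem_phaseSpace {x : Plane} (h : (x, (0 : Plane)) ∈ phaseSpace) :
    ‖x‖ < 1 := by
  have hx : ‖x‖ ≤ 1 := (mem_dataDomain_iff (q := (x, 0))).1 h.1
  refine lt_of_le_of_ne hx fun h1 => h.2 ⟨mem_circ_iff.2 h1, by simp⟩

/-! ### The unfolded datum -/

/-- The number of backward reflections that bring `q` into the disk. -/
def foldIndex (q : Plane × Plane) : ℤ := ⌈(-along q - halfChord q) / (2 * halfChord q)⌉

/-- The datum transported to all lines meeting the disk by unfolding the reflections. -/
def unfolded (f₀ : Plane × Plane → ℝ) (q : Plane × Plane) : ℝ := f₀ (billiard (foldIndex q) q)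

/-- The interval `[-σ, σ)` is a fundamental domain for translation by `2σ`. Being half-open it makes
the index unique, at the price of excluding the outgoing end of the chord. -/
lemma foldIndex_eq_iff {q : Plane × Plane} (hq : q ∈ chordSet) (k : ℤ) :
    foldIndex q = k ↔
      -halfChord q ≤ along q + 2 * k * halfChord q ∧ along q + 2 * k * halfChord q < halfChord q := by
  have hσ := halfChord_pos hq
  rw [foldIndex, Int.ceil_eq_iff, lt_div_iff₀ (by positivity), div_le_iff₀ (by positivity)]
  constructor <;> rintro ⟨h1, h2⟩ <;> constructor <;> nlinarith

lemma foldIndex_spec {q : Plane × Plane} (hq : q ∈ chordSet) :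
    -halfChord q ≤ along q + 2 * foldIndex q * halfChord q ∧
      along q + 2 * foldIndex q * halfChord q < halfChord q :=
  (foldIndex_eq_iff hq _).1 rfl

lemma foldIndex_billiard (k : ℤ) {q : Plane × Plane} (hq : q ∈ chordSet) :
    foldIndex (billiard k q) = foldIndex q - k := by
  rw [foldIndex_eq_iff (billiard_mem_chordSet k hq), along_billiard k hq.1, halfChord_billiard]
  have := foldIndex_spec hq
  push_cast
  constructor <;> nlinarith

lemma unfolded_billiard (f₀ : Plane × Plane → ℝ) (k : ℤ) {q : Plane × Plane}
    (hq : q ∈ chordSet) : unfolded f₀ (billiard k q) = unfolded f₀ q := by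
  rw [unfolded, foldIndex_billiard k hq, ← billiard_add, sub_add_cancel, unfolded]

lemma norm_fst_eq_one_of_along {q : Plane × Plane} (hq : q ∈ chordSet)
    (hs : along q = -halfChord q) : ‖q.1‖ = 1 := by
  have h1 := norm_fst_sq hq.1
  rw [hs, neg_sq, halfChord_sq hq] at h1
  nlinarith [norm_nonneg q.1]

lemma SpecularData.billiard_one {f₀ : Plane × Plane → ℝ} (hf : SpecularData f₀)
    {q : Plane × Plane} (hq : q ∈ chordSet) (hs : along q = -halfChord q) :
    f₀ (billiard 1 q) = f₀ q := by
  rw [billiard_one_of_along hq hs]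
  exact (hf q.1 (mem_circ_iff.2 (norm_fst_eq_one_of_along hq hs)) q.2).symm

lemma unfolded_eq {f₀ : Plane × Plane → ℝ} (hf : SpecularData f₀)
    {q : Plane × Plane} (hq : q ∈ chordSet) (h : ‖q.1‖ ≤ 1) : unfolded f₀ q = f₀ q := by
  have hσ := halfChord_pos hq
  obtain ⟨h1, h2⟩ := abs_le.1 ((norm_fst_le_one_iff hq).1 h)
  rcases h2.lt_or_eq with h3 | h3
  · rw [unfolded, (foldIndex_eq_iff hq 0).2 (by constructor <;> simp <;> linarith), billiard_zero]
  -- At the outgoing end the index is `-1`, and the specular condition at the incoming end of the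
  -- reflected chord restores `f₀ q`.
  · rw [unfolded, (foldIndex_eq_iff hq (-1)).2 (by constructor <;> push_cast <;> linarith)]
    have h4 := hf.billiard_one (billiard_mem_chordSet (-1) hq)
      (by rw [along_billiard _ hq.1, halfChord_billiard]; push_cast; linarith)
    rw [← h4, ← billiard_add]; simp

lemma unfolded_zero (f₀ : Plane × Plane → ℝ) (y : Plane) : unfolded f₀ (y, 0) = f₀ (y, 0) := by
  -- Division by zero gives `along = impact = 0` and `halfChord = 1`, so the index is `⌈-1/2⌉ = 0`.
  have : foldIndex (y, (0 : Plane)) = 0 := by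
    rw [foldIndex, Int.ceil_eq_iff]; simp [along, halfChord, impact]; norm_num
  rw [unfolded, this, billiard_zero]

lemma unfolded_eq_of_norm_lt {f₀ : Plane × Plane → ℝ} (hf : SpecularData f₀)
    {q : Plane × Plane} (h : ‖q.1‖ < 1) : unfolded f₀ q = f₀ q := by
  obtain ⟨y, v⟩ := q
  by_cases hv : v = 0
  · subst hv; exact unfolded_zero f₀ y
  · refine unfolded_eq hf (mem_chordSet_of_mem_phaseSpace ⟨mem_dataDomain_iff.2 h.le, ?_⟩ hv) h.le
    exact fun hg => h.ne (mem_circ_iff.1 hg.1)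

/-! ### Backward characteristics -/

lemma exitTime_eq {q : Plane × Plane} (hq : q ∈ chordSet) (h : ‖q.1‖ ≤ 1) :
    exitTime q.1 q.2 = ENNReal.ofReal ((along q + halfChord q) / ‖q.2‖) := by
  have hρ : 0 < ‖q.2‖ := norm_pos_iff.2 hq.1
  have hσ := halfChord_pos hq
  obtain ⟨h1, h2⟩ := abs_le.1 ((norm_fst_le_one_iff hq).1 h)
  have key : ∀ τ : ℝ, q.1 - τ • q.2 ∈ disk ↔ |along q - τ * ‖q.2‖| < halfChord q := by
    intro τ
    have e1 : impact (q.1 + (-τ) • q.2, q.2) = impact q := impact_shift _ _ _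
    have hmem : (q.1 + (-τ) • q.2, q.2) ∈ chordSet := ⟨hq.1, by rw [e1]; exact hq.2⟩
    have := norm_fst_lt_one_iff hmem
    rw [along_shift _ hq.1, halfChord, e1] at this
    rw [mem_disk_iff, sub_eq_add_neg, ← neg_smul, this, neg_mul, ← sub_eq_add_neg]
    rfl
  refine le_antisymm (sSup_le ?_) (ENNReal.le_of_forall_nnreal_lt fun r hr => ?_)
  · rintro _ ⟨τ, ⟨-, hmem⟩, rfl⟩
    refine ENNReal.ofReal_le_ofReal ?_
    rw [le_div_iff₀ hρ]
    have := abs_lt.1 ((key τ).1 hmem)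
    linarith
  · rw [ENNReal.lt_ofReal_iff_toReal_lt ENNReal.coe_ne_top, ENNReal.coe_toReal] at hr
    set T := (along q + halfChord q) / ‖q.2‖ with hT
    have hTρ : T * ‖q.2‖ = along q + halfChord q := div_mul_cancel₀ _ hρ.ne'
    have hr0 := r.2
    have hτ : (r : ℝ) ≤ (r + T) / 2 := by linarith
    -- The midpoint replaces `r` because `r = 0` may fail to be admissible: an outgoing boundary
    -- point is not in the open disk.
    refine le_trans ?_ (le_sSup ⟨((r : ℝ) + T) / 2, ⟨by linarith [NNReal.coe_nonneg r], ?_⟩, rfl⟩)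
    · rw [← ENNReal.ofReal_coe_nnreal]; exact ENNReal.ofReal_le_ofReal hτ
    · have hr1 : (0 : ℝ) ≤ r := r.2
      rw [key, abs_lt]
      have : 0 < (r + T) / 2 * ‖q.2‖ := by
        apply mul_pos _ hρ; linarith
      have : (r + T) / 2 * ‖q.2‖ < T * ‖q.2‖ := by
        apply mul_lt_mul_of_pos_right _ hρ; linarith
      constructor <;> linarith

lemma exitPoint_eq {q : Plane × Plane} (hq : q ∈ chordSet) (h : ‖q.1‖ ≤ 1) :
    exitPoint q.1 q.2 = q.1 + (-((along q + halfChord q) / ‖q.2‖)) • q.2 := by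
  obtain ⟨h1, h2⟩ := abs_le.1 ((norm_fst_le_one_iff hq).1 h)
  rw [exitPoint, exitTime_eq hq h, ENNReal.toReal_ofReal
    (div_nonneg (by linarith) (norm_nonneg _)), neg_smul, sub_eq_add_neg]

lemma shift_mem_chordSet {q : Plane × Plane} (hq : q ∈ chordSet) (c : ℝ) :
    (q.1 + c • q.2, q.2) ∈ chordSet :=
  ⟨hq.1, by rw [impact_shift]; exact hq.2⟩

lemma halfChord_shift (q : Plane × Plane) (c : ℝ) :
    halfChord (q.1 + c • q.2, q.2) = halfChord q := by
  rw [halfChord, impact_shift]; rfl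

lemma along_exit {q : Plane × Plane} (hq : q ∈ chordSet) :
    along (q.1 + (-((along q + halfChord q) / ‖q.2‖)) • q.2, q.2) = -halfChord q := by
  have hρ : ‖q.2‖ ≠ 0 := norm_ne_zero_iff.2 hq.1
  rw [along_shift _ hq.1]
  show along q + _ = _
  field_simp; ring

lemma bounce_step {q : Plane × Plane} (hq : q ∈ chordSet) (h : ‖q.1‖ ≤ 1) :
    (exitPoint q.1 q.2, refl (exitPoint q.1 q.2) q.2) =
      billiard 1 (q.1 + (-((along q + halfChord q) / ‖q.2‖)) • q.2, q.2) := by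
  rw [billiard_one_of_along (shift_mem_chordSet hq _)
    (by rw [along_exit hq, halfChord_shift]), exitPoint_eq hq h]

/-- The elapsed backward time at the `k`-th bounce. -/
def bounceDelay (q : Plane × Plane) : ℕ → ℝ
  | 0 => 0
  | k + 1 => (along q + (2 * k + 1) * halfChord q) / ‖q.2‖

lemma along_billiard_shift {q : Plane × Plane} (hq : q ∈ chordSet) (k : ℤ) (c : ℝ) :
    along (billiard k (q.1 + c • q.2, q.2)) = along q + c * ‖q.2‖ + 2 * k * halfChord q := by
  rw [along_billiard k (q := (q.1 + c • q.2, q.2)) hq.1, along_shift _ hq.1, halfChord_shift]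

lemma norm_billiard_shift_le_one_iff {q : Plane × Plane} (hq : q ∈ chordSet) (k : ℤ) (c : ℝ) :
    ‖(billiard k (q.1 + c • q.2, q.2)).1‖ ≤ 1 ↔
      |along q + c * ‖q.2‖ + 2 * k * halfChord q| ≤ halfChord q := by
  rw [norm_fst_le_one_iff (billiard_mem_chordSet k (shift_mem_chordSet hq c)),
    along_billiard_shift hq, halfChord_billiard, halfChord_shift]

lemma bounceDelay_mul_norm {q : Plane × Plane} (hq : q ∈ chordSet) (k : ℕ) :
    bounceDelay q (k + 1) * ‖q.2‖ = along q + (2 * k + 1) * halfChord q :=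
  div_mul_cancel₀ _ (norm_ne_zero_iff.2 hq.1)

lemma norm_billiard_bounceDelay {q : Plane × Plane} (hq : q ∈ chordSet) (h : ‖q.1‖ ≤ 1) (k : ℕ) :
    ‖(billiard k (q.1 + (-bounceDelay q k) • q.2, q.2)).1‖ ≤ 1 := by
  have hσ := halfChord_pos hq
  cases k with
  | zero => simpa [bounceDelay] using h
  | succ k =>
    rw [norm_billiard_shift_le_one_iff hq, neg_mul, bounceDelay_mul_norm hq, abs_le]
    push_cast
    constructor <;> linarith

lemma delay_step {q : Plane × Plane} (hq : q ∈ chordSet) (k : ℕ) :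
    (along (billiard k (q.1 + (-bounceDelay q k) • q.2, q.2)) + halfChord q) / ‖q.2‖ =
      bounceDelay q (k + 1) - bounceDelay q k := by
  have hρ : ‖q.2‖ ≠ 0 := norm_ne_zero_iff.2 hq.1
  rw [along_billiard_shift hq, div_eq_iff hρ, sub_mul, bounceDelay_mul_norm hq]
  push_cast; ring

/-- In the induction, the next stretch of free motion is moved before the reflections by
`billiard_shift`, and the next bounce is absorbed by `billiard_add`. -/
lemma bounce_eq {q : Plane × Plane} (hq : q ∈ chordSet) (h : ‖q.1‖ ≤ 1) (k : ℕ) :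
    bounce q.1 q.2 k = billiard k (q.1 + (-bounceDelay q k) • q.2, q.2) := by
  induction k with
  | zero => simp [bounce, bounceDelay]
  | succ k ih =>
    set z := billiard k (q.1 + (-bounceDelay q k) • q.2, q.2) with hz
    have hzc : z ∈ chordSet := billiard_mem_chordSet _ (shift_mem_chordSet hq _)
    have hzσ : halfChord z = halfChord q := by rw [hz, halfChord_billiard, halfChord_shift]
    have hzρ : ‖z.2‖ = ‖q.2‖ := by rw [hz, norm_billiard_snd]
    rw [bounce, ih, bounce_step hzc (norm_billiard_bounceDelay hq h k), hzσ, hzρ, delay_step hq,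
      hz, ← billiard_shift, ← billiard_add, add_assoc, ← add_smul, Nat.cast_succ, add_comm 1]
    congr 5
    ring

lemma bounceDelay_mono {q : Plane × Plane} (hq : q ∈ chordSet) (h : ‖q.1‖ ≤ 1) :
    Monotone (bounceDelay q) := by
  have hσ := halfChord_pos hq
  refine monotone_nat_of_le_succ fun k => ?_
  have h1 := abs_le.1 ((norm_fst_le_one_iff
    (billiard_mem_chordSet k (shift_mem_chordSet hq (-bounceDelay q k)))).1
    (norm_billiard_bounceDelay hq h k))
  rw [halfChord_billiard, halfChord_shift] at h1
  have h2 := delay_step hq k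
  have h3 : 0 ≤ bounceDelay q (k + 1) - bounceDelay q k := by
    rw [← h2]; exact div_nonneg (by linarith) (norm_nonneg _)
  linarith

lemma bounceTime_eq {q : Plane × Plane} (hq : q ∈ chordSet) (h : ‖q.1‖ ≤ 1) (t : ℝ) (k : ℕ) :
    bounceTime t q.1 q.2 k = ((t - bounceDelay q k : ℝ) : EReal) := by
  induction k with
  | zero => simp [bounceTime, bounceDelay]
  | succ k ih =>
    have hm := bounceDelay_mono hq h (Nat.le_succ k)
    have hzc := billiard_mem_chordSet k (shift_mem_chordSet hq (-bounceDelay q k))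
    rw [bounceTime, ih, bounce_eq hq h, exitTime_eq hzc (norm_billiard_bounceDelay hq h k),
      halfChord_billiard, halfChord_shift, norm_billiard_snd, delay_step hq,
      EReal.coe_ennreal_ofReal, max_eq_left (by simpa using hm), ← EReal.coe_sub]
    congr 1
    ring

lemma zero_mem_flight_iff {q : Plane × Plane} (hq : q ∈ chordSet) (h : ‖q.1‖ ≤ 1) (t : ℝ) (k : ℕ) :
    (0 : ℝ) ∈ flight t q.1 q.2 k ↔ t < bounceDelay q (k + 1) ∧ bounceDelay q k ≤ t := by
  simp only [flight, mem_ofPred_eq, bounceTime_eq hq h, EReal.coe_lt_coe_iff, EReal.coe_le_coe_iff,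
    sub_neg, sub_nonneg]

/-- From the first bounce on, consecutive delays differ by `2σ / |v| > 0`, so bounces do not
accumulate and only finitely many occur before time zero. -/
lemma exists_zero_mem_flight {q : Plane × Plane} (hq : q ∈ chordSet) (h : ‖q.1‖ ≤ 1) {t : ℝ}
    (ht : 0 ≤ t) : ∃ k, (0 : ℝ) ∈ flight t q.1 q.2 k := by
  have hσ := halfChord_pos hq
  have hρ : 0 < ‖q.2‖ := norm_pos_iff.2 hq.1
  have hex : ∃ k, t < bounceDelay q (k + 1) := by
    obtain ⟨k, hk⟩ := exists_nat_gt ((t * ‖q.2‖ - along q) / halfChord q)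
    refine ⟨k, ?_⟩
    rw [bounceDelay, lt_div_iff₀ hρ]
    rw [div_lt_iff₀ hσ] at hk
    have : (0 : ℝ) ≤ k := Nat.cast_nonneg k
    nlinarith
  classical
  refine ⟨Nat.find hex, (zero_mem_flight_iff hq h t _).2 ⟨Nat.find_spec hex, ?_⟩⟩
  rcases hk : Nat.find hex with _ | j
  · exact ht
  · exact not_lt.1 (Nat.find_min hex (m := j) (by omega))

/-- In terms of reflections, the backward characteristic at time zero. -/
lemma exists_char_eq_billiard {q : Plane × Plane} (hq : q ∈ chordSet) (h : ‖q.1‖ ≤ 1) {t : ℝ}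
    (ht : 0 ≤ t) : ∃ k : ℕ,
      (charX 0 t q.1 q.2, charV 0 t q.1 q.2) = billiard k (q.1 + (-t) • q.2, q.2) ∧
        ‖(billiard k (q.1 + (-t) • q.2, q.2)).1‖ ≤ 1 := by
  obtain ⟨k, hk⟩ := exists_zero_mem_flight hq h ht
  -- The delays are monotone, so the flight intervals are disjoint and each `finsum` has one nonzero
  -- term at most.
  have huniq : ∀ j, j ≠ k → (0 : ℝ) ∉ flight t q.1 q.2 j := by
    intro j hj hmem
    rw [zero_mem_flight_iff hq h] at hk hmem
    rcases lt_or_gt_of_ne hj with hlt | hlt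
    · have := bounceDelay_mono hq h (Nat.succ_le_of_lt hlt)
      simp only [Nat.succ_eq_add_one] at this; linarith
    · have := bounceDelay_mono hq h (Nat.succ_le_of_lt hlt)
      simp only [Nat.succ_eq_add_one] at this; linarith
  refine ⟨k, ?_, ?_⟩
  · rw [charX, charV, finsum_eq_single _ k (fun j hj => indicator_of_notMem (huniq j hj) _),
      finsum_eq_single _ k (fun j hj => indicator_of_notMem (huniq j hj) _),
      indicator_of_mem hk, indicator_of_mem hk, bounceTime_eq hq h, bounce_eq hq h,
      EReal.toReal_coe, sub_zero, sub_eq_add_neg _ (_ • _), ← neg_smul, ← billiard_shift, add_assoc,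
      ← add_smul]
    congr 5
    ring
  · have hσ := halfChord_pos hq
    have hρ : 0 < ‖q.2‖ := norm_pos_iff.2 hq.1
    obtain ⟨hs1, hs2⟩ := abs_le.1 ((norm_fst_le_one_iff hq).1 h)
    obtain ⟨h1, h2⟩ := (zero_mem_flight_iff hq h t k).1 hk
    have h3 := mul_lt_mul_of_pos_right h1 hρ
    rw [bounceDelay_mul_norm hq] at h3
    rw [norm_billiard_shift_le_one_iff hq, abs_le]
    push_cast
    refine ⟨by linarith, ?_⟩
    cases k with
    | zero => push_cast; nlinarith
    | succ k =>
      have h4 := mul_le_mul_of_nonneg_right h2 hρ.le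
      rw [bounceDelay_mul_norm hq] at h4
      push_cast at *; linarith

/-- The exit time is `⊤`, so every later bounce time is `⊥`: the initial flight interval reaches
back to `-∞` and the others are empty. -/
lemma char_zero_velocity {x : Plane} (hx : ‖x‖ < 1) {t : ℝ} (ht : 0 ≤ t) :
    charX 0 t x 0 = x ∧ charV 0 t x 0 = 0 := by
  have he : exitTime x 0 = ⊤ := by
    refine top_unique (ENNReal.le_of_forall_nnreal_lt fun r _ => ?_)
    refine le_sSup ⟨r, ⟨r.2, ?_⟩, ENNReal.ofReal_coe_nnreal⟩
    simpa [mem_disk_iff] using hx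
  have hb : ∀ k, bounce x 0 k = (x, 0) := by
    intro k
    induction k with
    | zero => rfl
    | succ k ih => rw [bounce, ih]; simp [exitPoint, refl_eq]
  have hbt : ∀ k, bounceTime t x 0 (k + 1) = ⊥ := by
    intro k
    rw [bounceTime, hb, he, EReal.coe_ennreal_top, EReal.sub_top]
  have h0 : (0 : ℝ) ∈ flight t x 0 0 :=
    ⟨by rw [hbt]; exact EReal.bot_lt_coe _, EReal.coe_le_coe_iff.2 ht⟩
  have huniq : ∀ j, j ≠ 0 → (0 : ℝ) ∉ flight t x 0 j := by
    rintro (_ | j) hj hmem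
    · exact hj rfl
    · have := hmem.2
      rw [hbt] at this
      exact absurd this (not_le.2 (EReal.bot_lt_coe _))
  rw [charX, charV, finsum_eq_single _ 0 (fun j hj => indicator_of_notMem (huniq j hj) _),
      finsum_eq_single _ 0 (fun j hj => indicator_of_notMem (huniq j hj) _),
      indicator_of_mem h0, indicator_of_mem h0]
  simp [bounce]

/-- The characteristic is free motion followed by some number of reflections, and the invariance of
`unfolded f₀` erases that number, which jumps as `(t, x, v)` varies. -/
lemma mildSol_eq_unfolded {f₀ : Plane × Plane → ℝ} (hf : SpecularData f₀) {t : ℝ} (ht : 0 ≤ t)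
    {x v : Plane} (h : (x, v) ∈ phaseSpace) :
    mildSol f₀ (t, x, v) = unfolded f₀ (x + (-t) • v, v) := by
  by_cases hv : v = 0
  · subst hv
    obtain ⟨h1, h2⟩ := char_zero_velocity (norm_lt_one_of_mem_phaseSpace h) ht
    simp only [mildSol, h1, h2, smul_zero, add_zero, unfolded_zero]
  · have hq := mem_chordSet_of_mem_phaseSpace h hv
    obtain ⟨k, hk1, hk2⟩ := exists_char_eq_billiard hq (mem_dataDomain_iff.1 h.1) ht
    have hs := shift_mem_chordSet hq (-t)
    rw [mildSol]
    simp only at hk1 hk2 hs ⊢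
    rw [hk1, ← unfolded_eq hf (billiard_mem_chordSet k hs) hk2, unfolded_billiard f₀ k hs]

/-! ### Compatibility conditions along the flow -/

lemma reflMat_mulVec_refl {x : Plane} (hx : ‖x‖ = 1) (v : Plane) :
    reflMat x *ᵥ (refl x v).ofLp = v.ofLp :=
  congrArg WithLp.ofLp (refl_refl hx v)

lemma vecMul_reflMat (x : Plane) (u : Fin 2 → ℝ) : u ᵥ* reflMat x = reflMat x *ᵥ u := by
  have h : (reflMat x)ᵀ = reflMat x := by
    simp [reflMat, transpose_vecMulVec]
  rw [← Matrix.mulVec_transpose, h]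

lemma rotTensor_mulVec_self (x v : Plane) : rotTensor x v *ᵥ v.ofLp = 0 := by
  ext i; fin_cases i <;>
    simp [rotTensor, rotQ, Matrix.mulVec, dotProduct, Fin.sum_univ_two] <;> ring

lemma vecMul_rotTensor_self (x v : Plane) : v.ofLp ᵥ* rotTensor x v = 0 := by
  ext i; fin_cases i <;>
    simp [rotTensor, rotQ, Matrix.vecMul, dotProduct, Fin.sum_univ_two] <;> ring

lemma matA_mulVec_self {v x : Plane} (h : inner ℝ v x ≠ (0 : ℝ)) : matA v x *ᵥ v.ofLp = 0 := by
  have h1 : (1 - (inner ℝ v (normal x) : ℝ)⁻¹ • vecMulVec v.ofLp (normal x).ofLp) *ᵥ v.ofLp = 0 := by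
    have h2 : (normal x).ofLp ⬝ᵥ v.ofLp = inner ℝ v (normal x) := by
      rw [plane_inner]; simp [dotProduct, Fin.sum_univ_two, mul_comm]
    have h3 : (inner ℝ v (normal x) : ℝ) ≠ 0 := h
    rw [Matrix.sub_mulVec, Matrix.smul_mulVec, Matrix.vecMulVec_mulVec, h2]
    ext i; simp; field_simp; simp
  rw [matA, ← Matrix.mulVec_mulVec, h1, Matrix.mulVec_zero]

lemma stack_mulVec_eq_zero {g : Fin 2 → ℝ} {M : Fin 2 → Matrix (Fin 2) (Fin 2) ℝ} {u : Fin 2 → ℝ}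
    (h : ∀ i, M i *ᵥ u = 0) : stack g M *ᵥ u = 0 := by
  ext i
  show (g ᵥ* M i) ⬝ᵥ u = 0
  rw [← Matrix.dotProduct_mulVec, h, dotProduct_zero]

lemma matJ_mulVec_self (x v : Plane) (i : Fin 2) : matJ x v i *ᵥ v.ofLp = 0 := by
  ext j; fin_cases i <;> fin_cases j <;>
    simp [matJ, Matrix.mulVec, dotProduct, Fin.sum_univ_two] <;> ring

lemma matK_mulVec_self (x v : Plane) (i : Fin 2) : matK x v i *ᵥ v.ofLp = 0 := by
  ext j; fin_cases i <;> fin_cases j <;>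
    simp [matK, Matrix.mulVec, dotProduct, Fin.sum_univ_two] <;> ring

/-- Pair condition (a) with `R_x v`: the reflection turns it into `v` on the left, and each tensor
`N` annihilates its own velocity. -/
lemma CompatC1.dotProduct_eq {f₀ : Plane × Plane → ℝ} (hf : CompatC1 f₀) {x v : Plane}
    (h : (x, v) ∈ incoming) :
    gradX f₀ x (refl x v) ⬝ᵥ (refl x v).ofLp = gradX f₀ x v ⬝ᵥ v.ofLp := by
  have h1 := congrArg (fun u => u ⬝ᵥ (refl x v).ofLp) (hf x v h)
  have hx : ‖x‖ = 1 := mem_circ_iff.1 h.1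
  simp only [add_dotProduct, ← Matrix.dotProduct_mulVec, reflMat_mulVec_refl hx,
    rotTensor_mulVec_self, dotProduct_zero, add_zero] at h1
  exact h1.symm

/-- Contract with `R_x v` on both sides. The tensors `N` vanish against their velocities from either
side, and `matA`, `matJ`, `matK` annihilate `v`, so only the two Hessians survive. -/
lemma CompatXX.quadForm_eq {f₀ : Plane × Plane → ℝ} (hf : CompatXX f₀) {x v : Plane}
    (h : (x, v) ∈ incoming) :
    (refl x v).ofLp ⬝ᵥ hessXX f₀ x (refl x v) *ᵥ (refl x v).ofLp =
      v.ofLp ⬝ᵥ hessXX f₀ x v *ᵥ v.ofLp := by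
  have hx : ‖x‖ = 1 := mem_circ_iff.1 h.1
  have hvx : inner ℝ v x ≠ (0 : ℝ) := h.2.ne
  have hl : ∀ w, (refl x v).ofLp ⬝ᵥ reflMat x *ᵥ w = v.ofLp ⬝ᵥ w := by
    intro w
    rw [Matrix.dotProduct_mulVec, vecMul_reflMat, reflMat_mulVec_refl hx]
  have hn : ∀ (y u : Plane) w, u.ofLp ⬝ᵥ rotTensor y u *ᵥ w = 0 := by
    intro y u w
    rw [Matrix.dotProduct_mulVec, vecMul_rotTensor_self, zero_dotProduct]
  have h1 := congrArg (fun M => (refl x v).ofLp ⬝ᵥ M *ᵥ (refl x v).ofLp) (hf x v h)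
  simp only [Matrix.add_mulVec, Matrix.sub_mulVec, Matrix.smul_mulVec, ← Matrix.mulVec_mulVec,
    reflMat_mulVec_refl hx, dotProduct_add, hl, hn, rotTensor_mulVec_self,
    matA_mulVec_self hvx, stack_mulVec_eq_zero (matJ_mulVec_self x v),
    stack_mulVec_eq_zero (matK_mulVec_self x v), Matrix.mulVec_zero, smul_zero,
    add_zero, sub_zero] at h1
  exact h1.symm

/-! ### Derivatives of the datum along the free flow -/

lemma uniqueDiffOn_dataDomain : UniqueDiffOn ℝ dataDomain := by
  refine UniqueDiffOn.prod (uniqueDiffOn_convex (convex_ball 0 1).closure ?_) uniqueDiffOn_univ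
  refine ⟨0, interior_mono subset_closure ?_⟩
  rw [disk, Metric.isOpen_ball.interior_eq]; simp

lemma isClosed_dataDomain : IsClosed dataDomain := isClosed_closure.prod isClosed_univ

/-- The derivative of `f₀` along the free flow. -/
def flowDeriv (f₀ : Plane × Plane → ℝ) (q : Plane × Plane) : ℝ :=
  fderivWithin ℝ f₀ dataDomain q (q.2, 0)

lemma inl_eq_sum (v : Plane) : ((v, 0) : Plane × Plane) =
    v 0 • (EuclideanSpace.single 0 1, 0) + v 1 • (EuclideanSpace.single 1 1, 0) := by
  refine Prod.ext (plane_ext ?_ ?_) ?_ <;> simp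

lemma flowDeriv_eq_dotProduct (f₀ : Plane × Plane → ℝ) (x v : Plane) :
    flowDeriv f₀ (x, v) = gradX f₀ x v ⬝ᵥ v.ofLp := by
  rw [flowDeriv, inl_eq_sum, map_add, map_smul, map_smul]
  simp [gradX, dX, dotProduct, Fin.sum_univ_two, mul_comm]

lemma mem_incoming_of_along {q : Plane × Plane} (hq : q ∈ chordSet)
    (hs : along q = -halfChord q) : (q.1, q.2) ∈ incoming := by
  refine ⟨mem_circ_iff.2 (norm_fst_eq_one_of_along hq hs), ?_⟩
  have h : inner ℝ q.1 q.2 = along q * ‖q.2‖ := (div_mul_cancel₀ _ (norm_ne_zero_iff.2 hq.1)).symm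
  rw [real_inner_comm, normal, h, hs]
  nlinarith [mul_pos (halfChord_pos hq) (norm_pos_iff.2 hq.1)]

lemma CompatC1.flowDeriv_billiard {f₀ : Plane × Plane → ℝ} (hf : CompatC1 f₀)
    {q : Plane × Plane} (hq : q ∈ chordSet) (hs : along q = -halfChord q) :
    flowDeriv f₀ (billiard 1 q) = flowDeriv f₀ q := by
  rw [billiard_one_of_along hq hs, flowDeriv_eq_dotProduct,
    hf.dotProduct_eq (mem_incoming_of_along hq hs), ← flowDeriv_eq_dotProduct]

/-- The second derivative of the datum. -/
def sndDeriv (f₀ : Plane × Plane → ℝ) (q : Plane × Plane) :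
    (Plane × Plane) →L[ℝ] (Plane × Plane) →L[ℝ] ℝ :=
  fderivWithin ℝ (fderivWithin ℝ f₀ dataDomain) dataDomain q

lemma hasFDerivWithinAt_fderivWithin {f₀ : Plane × Plane → ℝ} (hf : ContDiffOn ℝ 2 f₀ dataDomain)
    {q : Plane × Plane} (hq : q ∈ dataDomain) :
    HasFDerivWithinAt (fderivWithin ℝ f₀ dataDomain) (sndDeriv f₀ q) dataDomain q :=
  ((hf.fderivWithin (m := 1) uniqueDiffOn_dataDomain (by norm_num)).differentiableOn
    one_ne_zero q hq).hasFDerivWithinAt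

lemma continuousOn_sndDeriv {f₀ : Plane × Plane → ℝ} (hf : ContDiffOn ℝ 2 f₀ dataDomain) :
    ContinuousOn (sndDeriv f₀) dataDomain :=
  (hf.fderivWithin (m := 1) uniqueDiffOn_dataDomain (by norm_num)).continuousOn_fderivWithin
    uniqueDiffOn_dataDomain le_rfl

/-- Symmetry reaches the boundary because the domain lies in the closure of its interior. -/
lemma sndDeriv_symm {f₀ : Plane × Plane → ℝ} (hf : ContDiffOn ℝ 2 f₀ dataDomain)
    {q : Plane × Plane} (hq : q ∈ dataDomain) (η ζ : Plane × Plane) :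
    sndDeriv f₀ q η ζ = sndDeriv f₀ q ζ η := by
  refine (hf q hq).isSymmSndFDerivWithinAt (by simp) uniqueDiffOn_dataDomain ?_ hq η ζ
  have hint : interior dataDomain = disk ×ˢ univ := by
    rw [dataDomain, interior_prod_eq, interior_univ, disk, closure_ball _ one_ne_zero,
      interior_closedBall _ one_ne_zero]
  rw [hint, closure_prod_eq, closure_univ]; exact hq

/-- The derivative of `flowDeriv f₀`. -/
def fderivFlowDeriv (f₀ : Plane × Plane → ℝ) (q : Plane × Plane) : (Plane × Plane) →L[ℝ] ℝ :=
  (fderivWithin ℝ f₀ dataDomain q).comp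
      ((ContinuousLinearMap.inl ℝ Plane Plane).comp (ContinuousLinearMap.snd ℝ Plane Plane)) +
    (sndDeriv f₀ q).flip (q.2, 0)

lemma fderivFlowDeriv_apply (f₀ : Plane × Plane → ℝ) (q η : Plane × Plane) :
    fderivFlowDeriv f₀ q η =
      fderivWithin ℝ f₀ dataDomain q (η.2, 0) + sndDeriv f₀ q η (q.2, 0) := rfl

lemma hasFDerivWithinAt_flowDeriv {f₀ : Plane × Plane → ℝ} (hf : ContDiffOn ℝ 2 f₀ dataDomain)
    {q : Plane × Plane} (hq : q ∈ dataDomain) :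
    HasFDerivWithinAt (flowDeriv f₀) (fderivFlowDeriv f₀ q) dataDomain q :=
  (hasFDerivWithinAt_fderivWithin hf hq).clm_apply
    ((ContinuousLinearMap.inl ℝ Plane Plane).comp
      (ContinuousLinearMap.snd ℝ Plane Plane)).hasFDerivWithinAt

/-- A purely spatial displacement leaves the direction `(v, 0)` unchanged, so only the Hessian term
contributes. -/
lemma fderivFlowDeriv_flow {f₀ : Plane × Plane → ℝ} (hf : ContDiffOn ℝ 2 f₀ dataDomain)
    {x v : Plane} (hq : (x, v) ∈ dataDomain) :
    fderivFlowDeriv f₀ (x, v) (v, 0) = v.ofLp ⬝ᵥ hessXX f₀ x v *ᵥ v.ofLp := by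
  have key : ∀ i j, hessXX f₀ x v i j =
      sndDeriv f₀ (x, v) (EuclideanSpace.single j 1, 0) (EuclideanSpace.single i 1, 0) := by
    intro i j
    have h := (hasFDerivWithinAt_fderivWithin hf hq).clm_apply
      (hasFDerivWithinAt_const ((EuclideanSpace.single i 1, 0) : Plane × Plane) (x, v) dataDomain)
    have h2 := congrArg (fun L => L (EuclideanSpace.single j 1, 0))
      (h.fderivWithin (uniqueDiffOn_dataDomain _ hq))
    simp only [ContinuousLinearMap.comp_zero, zero_add] at h2
    exact h2
  rw [fderivFlowDeriv_apply]
  have h0 : (((v, 0) : Plane × Plane).2, (0 : Plane)) = 0 := rfl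
  rw [h0, map_zero, zero_add]
  simp only [inl_eq_sum v, map_add, map_smul, _root_.add_apply,
    _root_.smul_apply, smul_eq_mul, dotProduct, Matrix.mulVec, Fin.sum_univ_two, key]
  ring

lemma CompatXX.fderivFlowDeriv_billiard {f₀ : Plane × Plane → ℝ}
    (hf : ContDiffOn ℝ 2 f₀ dataDomain) (hc : CompatXX f₀)
    {q : Plane × Plane} (hq : q ∈ chordSet) (hs : along q = -halfChord q) :
    fderivFlowDeriv f₀ (billiard 1 q) ((billiard 1 q).2, 0) = fderivFlowDeriv f₀ q (q.2, 0) := by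
  have hn := norm_fst_eq_one_of_along hq hs
  obtain ⟨x, v⟩ := q
  rw [billiard_one_of_along hq hs]
  simp only
  rw [fderivFlowDeriv_flow hf (v := v) (mem_dataDomain_iff.2 hn.le),
    fderivFlowDeriv_flow hf (v := refl x v) (mem_dataDomain_iff.2 hn.le),
    hc.quadForm_eq (mem_incoming_of_along hq hs)]

/-! ### Gluing along the incoming boundary -/

section transversal

variable {E F : Type*} [NormedAddCommGroup E] [NormedSpace ℝ E] [NormedAddCommGroup F]
  [NormedSpace ℝ F]

/-- Two functions that agree on the image of a projection along `ζ`, and whose derivatives agree in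
the direction `ζ`, have the same derivative. -/
lemma fderiv_eq_of_projection {a b : E → F} {a' b' : E →L[ℝ] F} {A B : Set E} {p ζ : E}
    {proj : E → E} {l : E →L[ℝ] ℝ} (ha : HasFDerivWithinAt a a' A p)
    (hb : HasFDerivWithinAt b b' B p)
    (hproj : HasFDerivAt proj (ContinuousLinearMap.id ℝ E - l.smulRight ζ) p) (hp : proj p = p)
    (hmem : ∀ᶠ q in nhds p, proj q ∈ A ∧ proj q ∈ B ∧ a (proj q) = b (proj q))
    (hζ : a' ζ = b' ζ) : a' = b' := by
  have h1 : HasFDerivAt (a ∘ proj) (a'.comp (ContinuousLinearMap.id ℝ E - l.smulRight ζ)) p := by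
    have := (hp.symm ▸ ha : HasFDerivWithinAt a a' A (proj p)).comp p
      (hproj.hasFDerivWithinAt (s := proj ⁻¹' A)) (mapsTo_preimage _ _)
    exact this.hasFDerivAt (hmem.mono fun q hq => hq.1)
  have h2 : HasFDerivAt (b ∘ proj) (b'.comp (ContinuousLinearMap.id ℝ E - l.smulRight ζ)) p := by
    have := (hp.symm ▸ hb : HasFDerivWithinAt b b' B (proj p)).comp p
      (hproj.hasFDerivWithinAt (s := proj ⁻¹' B)) (mapsTo_preimage _ _)
    exact this.hasFDerivAt (hmem.mono fun q hq => hq.2.1)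
  have h3 := h1.unique (h2.congr_of_eventuallyEq (hmem.mono fun q hq => hq.2.2))
  -- The two derivatives agree on every `η - l η • ζ`; the hypothesis on `ζ` supplies the rest.
  ext η
  have h4 := congrArg (fun L => L η) h3
  simp only [ContinuousLinearMap.comp_apply, _root_.sub_apply,
    ContinuousLinearMap.id_apply, ContinuousLinearMap.smulRight_apply, map_sub, map_smul, hζ] at h4
  exact sub_left_injective h4

end transversal

/-- The projection onto the incoming boundary along the free flow. -/
def exitProj (q : Plane × Plane) : Plane × Plane :=
  (q.1 + (-((along q + halfChord q) / ‖q.2‖)) • q.2, q.2)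

/-- On the incoming boundary the travel time vanishes, so the derivative differs from the identity
only by the variation of that time, in the direction `(v, 0)`. -/
lemma hasFDerivAt_exitProj {p : Plane × Plane} (hp : p ∈ chordSet) (hs : along p = -halfChord p) :
    ∃ l : (Plane × Plane) →L[ℝ] ℝ, HasFDerivAt exitProj
      (ContinuousLinearMap.id ℝ (Plane × Plane) - l.smulRight (p.2, 0)) p := by
  have hc : DifferentiableAt ℝ (fun q => -((along q + halfChord q) / ‖q.2‖)) p :=
    (((contDiffAt_along (n := 1) hp.1).add (contDiffAt_halfChord hp)).div
      (contDiffAt_norm_snd hp.1) (norm_ne_zero_iff.2 hp.1)).neg.differentiableAt one_ne_zero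
  have h0 : -((along p + halfChord p) / ‖p.2‖) = 0 := by rw [hs]; simp
  refine ⟨-fderiv ℝ (fun q => -((along q + halfChord q) / ‖q.2‖)) p, ?_⟩
  have h := (hasFDerivAt_fst (𝕜 := ℝ) (p := p)).add (hc.hasFDerivAt.smul (hasFDerivAt_snd (p := p)))
  refine (h.prodMk (hasFDerivAt_snd (p := p))).congr_fderiv ?_
  rw [h0]
  ext η <;> simp [sub_eq_add_neg]

lemma exitProj_mem {q : Plane × Plane} (hq : q ∈ chordSet) :
    exitProj q ∈ chordSet ∧ along (exitProj q) = -halfChord (exitProj q) :=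
  ⟨shift_mem_chordSet hq _, by rw [exitProj, along_exit hq, halfChord_shift]⟩

lemma mem_dataDomain_of_along {q : Plane × Plane} (hq : q ∈ chordSet)
    (hs : along q = -halfChord q) : q ∈ dataDomain ∧ billiard 1 q ∈ dataDomain := by
  have h := norm_fst_eq_one_of_along hq hs
  rw [billiard_one_of_along hq hs]
  exact ⟨mem_dataDomain_iff.2 h.le, mem_dataDomain_iff.2 h.le⟩

/-- A neighbourhood of the incoming boundary. -/
def exitStrip : Set (Plane × Plane) :=
  {q | q ∈ chordSet ∧ -3 * halfChord q < along q ∧ along q < halfChord q}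

lemma isOpen_exitStrip : IsOpen exitStrip := by
  rw [isOpen_iff_mem_nhds]
  intro q hq
  have ha := (contDiffAt_along (n := 0) hq.1.1).continuousAt
  have hσ := (contDiffAt_halfChord (n := 0) hq.1).continuousAt
  filter_upwards [isOpen_chordSet.mem_nhds hq.1,
    (continuousAt_const.mul hσ).eventually_lt ha hq.2.1, ha.eventually_lt hσ hq.2.2]
    with p h1 h2 h3 using ⟨h1, h2, h3⟩

/-- `billiard 1` adds `2σ` to `along`. Hence the part `[-σ, σ)` of the strip lies in the domain, the
part `(-3σ, -σ]` is sent into it, and the two meet in the incoming boundary. -/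
lemma exitStrip_mem_iff {q : Plane × Plane} (hq : q ∈ exitStrip) :
    (q ∈ dataDomain ↔ -halfChord q ≤ along q) ∧
      (billiard 1 q ∈ dataDomain ↔ along q ≤ -halfChord q) := by
  rw [mem_dataDomain_iff, mem_dataDomain_iff, norm_fst_le_one_iff hq.1,
    norm_fst_le_one_iff (billiard_mem_chordSet 1 hq.1), along_billiard _ hq.1.1,
    halfChord_billiard, abs_le, abs_le]
  obtain ⟨-, h1, h2⟩ := hq
  push_cast
  refine ⟨⟨fun h => h.1, fun h => ⟨h, h2.le⟩⟩, fun h => ?_, fun h => ⟨?_, ?_⟩⟩ <;> linarith [h]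

section glue

variable {F : Type*} [NormedAddCommGroup F] [NormedSpace ℝ F]
  {φ a b : Plane × Plane → F} {a' b' : Plane × Plane → (Plane × Plane) →L[ℝ] F}

lemma notMem_closure_dataDomain_inter {p : Plane × Plane} (h : p ∉ dataDomain) :
    p ∉ closure (dataDomain ∩ exitStrip) := fun hc =>
  h (isClosed_dataDomain.closure_subset (closure_mono inter_subset_left hc))

lemma notMem_closure_preimage_inter {p : Plane × Plane} (hp : p ∈ chordSet)
    (h : billiard 1 p ∉ dataDomain) : p ∉ closure (billiard 1 ⁻¹' dataDomain ∩ exitStrip) := by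
  rw [mem_closure_iff_frequently, Filter.not_frequently]
  filter_upwards [(contDiffAt_billiard (n := 0) 1 hp).continuousAt.preimage_mem_nhds
    (isClosed_dataDomain.isOpen_compl.mem_nhds h)] with q hq hq' using hq hq'.1

lemma union_mem_nhds {p : Plane × Plane} (hp : p ∈ exitStrip) :
    (dataDomain ∩ exitStrip) ∪ (billiard 1 ⁻¹' dataDomain ∩ exitStrip) ∈ nhds p := by
  filter_upwards [isOpen_exitStrip.mem_nhds hp] with q hq
  obtain ⟨h1, h2⟩ := exitStrip_mem_iff hq
  rcases le_total (-halfChord q) (along q) with h | h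
  · exact Or.inl ⟨h1.2 h, hq⟩
  · exact Or.inr ⟨h2.2 h, hq⟩

/-- Equality on the boundary handles the tangential directions; the flow direction `(v, 0)` is
transversal and is the only one to be checked. -/
lemma fderiv_eq_on_exit {a' b' : (Plane × Plane) →L[ℝ] F} {p : Plane × Plane} (hp : p ∈ chordSet)
    (hs : along p = -halfChord p) (ha : HasFDerivWithinAt a a' dataDomain p)
    (hb : HasFDerivWithinAt b b' (billiard 1 ⁻¹' dataDomain) p)
    (hab : ∀ q ∈ chordSet, along q = -halfChord q → a q = b q)
    (hζ : a' (p.2, 0) = b' (p.2, 0)) : a' = b' := by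
  obtain ⟨l, hl⟩ := hasFDerivAt_exitProj hp hs
  refine fderiv_eq_of_projection ha hb hl (by rw [exitProj, hs]; simp) ?_ hζ
  filter_upwards [isOpen_chordSet.mem_nhds hp] with q hq
  obtain ⟨h1, h2⟩ := exitProj_mem hq
  exact ⟨(mem_dataDomain_of_along h1 h2).1, (mem_dataDomain_of_along h1 h2).2, hab _ h1 h2⟩

/-- The two closed halves cover a neighbourhood, so derivatives within each of them combine. At a
point outside one half, differentiability within that half is vacuous. -/
lemma hasFDerivAt_glued
    (hφa : ∀ q ∈ exitStrip, q ∈ dataDomain → φ q = a q)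
    (hφb : ∀ q ∈ exitStrip, billiard 1 q ∈ dataDomain → φ q = b q)
    (ha : ∀ q ∈ dataDomain, HasFDerivWithinAt a (a' q) dataDomain q)
    (hb : ∀ q ∈ chordSet, billiard 1 q ∈ dataDomain →
      HasFDerivWithinAt b (b' q) (billiard 1 ⁻¹' dataDomain) q)
    (hab : ∀ q ∈ chordSet, along q = -halfChord q → a' q = b' q)
    {p : Plane × Plane} (hp : p ∈ exitStrip) :
    (p ∈ dataDomain → HasFDerivAt φ (a' p) p) ∧
      (billiard 1 p ∈ dataDomain → HasFDerivAt φ (b' p) p) := by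
  have hA : p ∈ dataDomain → HasFDerivWithinAt φ (a' p) (dataDomain ∩ exitStrip) p := fun h =>
    ((ha p h).mono inter_subset_left).congr (fun q hq => hφa q hq.2 hq.1) (hφa p hp h)
  have hB : billiard 1 p ∈ dataDomain →
      HasFDerivWithinAt φ (b' p) (billiard 1 ⁻¹' dataDomain ∩ exitStrip) p := fun h =>
    ((hb p hp.1 h).mono inter_subset_left).congr (fun q hq => hφb q hq.2 hq.1) (hφb p hp h)
  have heq : p ∈ dataDomain → billiard 1 p ∈ dataDomain → a' p = b' p := fun h1 h2 =>
    hab p hp.1 (le_antisymm ((exitStrip_mem_iff hp).2.1 h2) ((exitStrip_mem_iff hp).1.1 h1))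
  constructor
  · intro h
    refine ((hA h).union ?_).hasFDerivAt (union_mem_nhds hp)
    by_cases h' : billiard 1 p ∈ dataDomain
    · rw [heq h h']; exact hB h'
    · exact .of_notMem_closure (notMem_closure_preimage_inter hp.1 h')
  · intro h
    refine (HasFDerivWithinAt.union ?_ (hB h)).hasFDerivAt (union_mem_nhds hp)
    by_cases h' : p ∈ dataDomain
    · rw [← heq h' h]; exact hA h'
    · exact .of_notMem_closure (notMem_closure_dataDomain_inter h')

lemma continuousOn_glued {X : Type*} [TopologicalSpace X] {φ a b : Plane × Plane → X}
    (hφa : ∀ q ∈ exitStrip, q ∈ dataDomain → φ q = a q)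
    (hφb : ∀ q ∈ exitStrip, billiard 1 q ∈ dataDomain → φ q = b q)
    (ha : ContinuousOn a dataDomain)
    (hb : ∀ q ∈ chordSet, billiard 1 q ∈ dataDomain →
      ContinuousWithinAt b (billiard 1 ⁻¹' dataDomain) q) :
    ContinuousOn φ exitStrip := by
  intro p hp
  refine ContinuousAt.continuousWithinAt ?_
  refine (ContinuousWithinAt.union ?_ ?_).continuousAt (union_mem_nhds hp)
  · by_cases h : p ∈ dataDomain
    · exact ((ha p h).mono inter_subset_left).congr (fun q hq => hφa q hq.2 hq.1) (hφa p hp h)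
    · exact continuousWithinAt_of_notMem_closure (notMem_closure_dataDomain_inter h)
  · by_cases h : billiard 1 p ∈ dataDomain
    · exact ((hb p hp.1 h).mono inter_subset_left).congr (fun q hq => hφb q hq.2 hq.1) (hφb p hp h)
    · exact continuousWithinAt_of_notMem_closure (notMem_closure_preimage_inter hp.1 h)

/-- A function glued from two continuously differentiable pieces. -/
lemma contDiffOn_one_glued
    (hφa : ∀ q ∈ exitStrip, q ∈ dataDomain → φ q = a q)
    (hφb : ∀ q ∈ exitStrip, billiard 1 q ∈ dataDomain → φ q = b q)
    (ha : ∀ q ∈ dataDomain, HasFDerivWithinAt a (a' q) dataDomain q)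
    (hb : ∀ q ∈ chordSet, billiard 1 q ∈ dataDomain →
      HasFDerivWithinAt b (b' q) (billiard 1 ⁻¹' dataDomain) q)
    (hab : ∀ q ∈ chordSet, along q = -halfChord q → a' q = b' q)
    (ha' : ContinuousOn a' dataDomain)
    (hb' : ∀ q ∈ chordSet, billiard 1 q ∈ dataDomain →
      ContinuousWithinAt b' (billiard 1 ⁻¹' dataDomain) q) :
    ContDiffOn ℝ 1 φ exitStrip := by
  have h := fun p hp => hasFDerivAt_glued hφa hφb ha hb hab (p := p) hp
  have hd : DifferentiableOn ℝ φ exitStrip := by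
    intro p hp
    rcases le_total (-halfChord p) (along p) with hs | hs
    · exact ((h p hp).1 ((exitStrip_mem_iff hp).1.2 hs)).differentiableAt.differentiableWithinAt
    · exact ((h p hp).2 ((exitStrip_mem_iff hp).2.2 hs)).differentiableAt.differentiableWithinAt
  rw [show (1 : WithTop ℕ∞) = 0 + 1 from rfl, contDiffOn_succ_iff_fderiv_of_isOpen isOpen_exitStrip]
  refine ⟨hd, by simp, contDiffOn_zero.2 ?_⟩
  exact continuousOn_glued (a := a') (b := b') (fun q hq hm => ((h q hq).1 hm).fderiv)
    (fun q hq hm => ((h q hq).2 hm).fderiv) ha' hb'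

end glue

/-! ### Regularity of the unfolded datum -/

lemma hasFDerivAt_billiard (k : ℤ) {q : Plane × Plane} (hq : q ∈ chordSet) :
    HasFDerivAt (billiard k) (fderiv ℝ (billiard k) q) q :=
  ((contDiffAt_billiard (n := 1) k hq).differentiableAt one_ne_zero).hasFDerivAt

/-- This is the commutation with free motion, differentiated at displacement zero. -/
lemma fderiv_billiard_flow (k : ℤ) {q : Plane × Plane} (hq : q ∈ chordSet) :
    fderiv ℝ (billiard k) q (q.2, 0) = ((billiard k q).2, 0) := by
  have h1 : HasDerivAt (fun c : ℝ => ((q.1 + c • q.2, q.2) : Plane × Plane)) (q.2, 0) 0 := by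
    have := ((hasDerivAt_id (0 : ℝ)).smul_const q.2).const_add q.1
    simpa using this.prodMk (hasDerivAt_const (0 : ℝ) q.2)
  have h2 : HasDerivAt (fun c : ℝ => billiard k (q.1 + c • q.2, q.2))
      (fderiv ℝ (billiard k) q (q.2, 0)) 0 := by
    have h0 : HasFDerivAt (billiard k) (fderiv ℝ (billiard k) q) (q.1 + (0 : ℝ) • q.2, q.2) := by
      simpa using hasFDerivAt_billiard k hq
    exact h0.comp_hasDerivAt (0 : ℝ) h1
  have h3 : HasDerivAt (fun c : ℝ => billiard k (q.1 + c • q.2, q.2)) ((billiard k q).2, 0) 0 := by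
    simp only [billiard_shift]
    have := ((hasDerivAt_id (0 : ℝ)).smul_const (billiard k q).2).const_add (billiard k q).1
    simpa using this.prodMk (hasDerivAt_const (0 : ℝ) (billiard k q).2)
  exact h2.unique h3

lemma hasFDerivAt_fderiv_billiard (k : ℤ) {q : Plane × Plane} (hq : q ∈ chordSet) :
    HasFDerivAt (fderiv ℝ (billiard k)) (fderiv ℝ (fderiv ℝ (billiard k)) q) q :=
  (((contDiffAt_billiard (n := 2) k hq).fderiv_right (m := 1) (by norm_num)).differentiableAt
    one_ne_zero).hasFDerivAt

/-- Obtained by differentiating `fderiv_billiard_flow` in the base point; the last term arises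
because the direction `(q.2, 0)` itself moves. -/
lemma fderiv_fderiv_billiard_flow (k : ℤ) {q : Plane × Plane} (hq : q ∈ chordSet)
    (η : Plane × Plane) :
    fderiv ℝ (fderiv ℝ (billiard k)) q (q.2, 0) η =
      ((fderiv ℝ (billiard k) q η).2, 0) - fderiv ℝ (billiard k) q (η.2, 0) := by
  rw [(contDiffAt_billiard (n := 2) k hq).isSymmSndFDerivAt (by simp)]
  have h1 := (hasFDerivAt_fderiv_billiard k hq).clm_apply
    ((ContinuousLinearMap.inl ℝ Plane Plane).comp
      (ContinuousLinearMap.snd ℝ Plane Plane)).hasFDerivAt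
  have h2 := (((ContinuousLinearMap.inl ℝ Plane Plane).comp
      (ContinuousLinearMap.snd ℝ Plane Plane)).hasFDerivAt (x := billiard k q)).comp q
      (hasFDerivAt_billiard k hq)
  have h3 := h1.unique (h2.congr_of_eventuallyEq (by
    filter_upwards [isOpen_chordSet.mem_nhds hq] with p hp using fderiv_billiard_flow k hp))
  have h4 := congrArg (fun L => L η) h3
  exact eq_sub_of_add_eq' h4

lemma unfolded_eq_of_mem {f₀ : Plane × Plane → ℝ} (hf : SpecularData f₀) :
    (∀ q ∈ exitStrip, q ∈ dataDomain → unfolded f₀ q = f₀ q) ∧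
      ∀ q ∈ exitStrip, billiard 1 q ∈ dataDomain → unfolded f₀ q = f₀ (billiard 1 q) := by
  refine ⟨fun q hq h => unfolded_eq hf hq.1 (mem_dataDomain_iff.1 h), fun q hq h => ?_⟩
  rw [← unfolded_eq hf (billiard_mem_chordSet 1 hq.1) (mem_dataDomain_iff.1 h),
    unfolded_billiard f₀ 1 hq.1]

section regularity

variable {f₀ : Plane × Plane → ℝ}

lemma hasFDerivWithinAt_comp_billiard {F : Type*} [NormedAddCommGroup F] [NormedSpace ℝ F]
    {h : Plane × Plane → F} {h' : (Plane × Plane) →L[ℝ] F} {q : Plane × Plane} (hq : q ∈ chordSet)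
    (hh : HasFDerivWithinAt h h' dataDomain (billiard 1 q)) :
    HasFDerivWithinAt (fun q => h (billiard 1 q)) (h'.comp (fderiv ℝ (billiard 1) q))
      (billiard 1 ⁻¹' dataDomain) q :=
  hh.comp q (hasFDerivAt_billiard 1 hq).hasFDerivWithinAt (mapsTo_preimage _ _)

lemma fderivWithin_eq_on_exit (hd : ContDiffOn ℝ 1 f₀ dataDomain) (hf : SpecularData f₀)
    (hc : CompatC1 f₀) {q : Plane × Plane} (hq : q ∈ chordSet) (hs : along q = -halfChord q) :
    fderivWithin ℝ f₀ dataDomain q =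
      (fderivWithin ℝ f₀ dataDomain (billiard 1 q)).comp (fderiv ℝ (billiard 1) q) := by
  obtain ⟨h1, h2⟩ := mem_dataDomain_of_along hq hs
  have hd' := fun q hq => (hd.differentiableOn one_ne_zero q hq).hasFDerivWithinAt
  refine fderiv_eq_on_exit hq hs (hd' q h1) (hasFDerivWithinAt_comp_billiard hq (hd' _ h2))
    (fun p hp hs => (hf.billiard_one hp hs).symm) ?_
  rw [ContinuousLinearMap.comp_apply, fderiv_billiard_flow 1 hq]
  exact (hc.flowDeriv_billiard hq hs).symm

lemma contDiffOn_one_unfolded_exitStrip (hd : ContDiffOn ℝ 1 f₀ dataDomain)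
    (hf : SpecularData f₀) (hc : CompatC1 f₀) : ContDiffOn ℝ 1 (unfolded f₀) exitStrip := by
  have hd' := fun q hq => (hd.differentiableOn one_ne_zero q hq).hasFDerivWithinAt
  have hcont := hd.continuousOn_fderivWithin uniqueDiffOn_dataDomain le_rfl
  refine contDiffOn_one_glued (unfolded_eq_of_mem hf).1 (unfolded_eq_of_mem hf).2 hd'
    (fun q hq h => hasFDerivWithinAt_comp_billiard hq (hd' _ h))
    (fun q hq hs => fderivWithin_eq_on_exit hd hf hc hq hs) hcont ?_
  intro q hq h
  exact ((hcont _ h).comp (contDiffAt_billiard (n := 0) 1 hq).continuousAt.continuousWithinAt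
    (mapsTo_preimage _ _)).clm_comp
    (hasFDerivAt_fderiv_billiard 1 hq).continuousAt.continuousWithinAt

lemma contDiffOn_two_unfolded_exitStrip (hd : ContDiffOn ℝ 2 f₀ dataDomain)
    (hf : SpecularData f₀) (hc : CompatC1 f₀) (hxx : CompatXX f₀) :
    ContDiffOn ℝ 2 (unfolded f₀) exitStrip := by
  have hd1 : ContDiffOn ℝ 1 f₀ dataDomain := hd.of_le (by norm_num)
  have hd' := fun q hq => (hd1.differentiableOn one_ne_zero q hq).hasFDerivWithinAt
  have hfst := fun p hp => hasFDerivAt_glued (unfolded_eq_of_mem hf).1 (unfolded_eq_of_mem hf).2 hd'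
    (fun q hq h => hasFDerivWithinAt_comp_billiard hq (hd' _ h))
    (fun q hq hs => fderivWithin_eq_on_exit hd1 hf hc hq hs) (p := p) hp
  have hC1 := contDiffOn_one_unfolded_exitStrip hd1 hf hc
  have hb : ∀ q ∈ chordSet, billiard 1 q ∈ dataDomain → HasFDerivWithinAt
      (fun q => (fderivWithin ℝ f₀ dataDomain (billiard 1 q)).comp (fderiv ℝ (billiard 1) q)) _
      (billiard 1 ⁻¹' dataDomain) q := fun q hq h =>
    (hasFDerivWithinAt_comp_billiard hq (hasFDerivWithinAt_fderivWithin hd h)).clm_comp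
      (hasFDerivAt_fderiv_billiard 1 hq).hasFDerivWithinAt
  rw [show (2 : WithTop ℕ∞) = 1 + 1 from by norm_num,
    contDiffOn_succ_iff_fderiv_of_isOpen isOpen_exitStrip]
  refine ⟨hC1.differentiableOn one_ne_zero, by simp, ?_⟩
  refine contDiffOn_one_glued (fun q hq hm => ((hfst q hq).1 hm).fderiv)
    (fun q hq hm => ((hfst q hq).2 hm).fderiv) (fun q hq => hasFDerivWithinAt_fderivWithin hd hq)
    hb ?_ (continuousOn_sndDeriv hd) ?_
  · intro q hq hs
    obtain ⟨h1, h2⟩ := mem_dataDomain_of_along hq hs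
    refine fderiv_eq_on_exit hq hs (hasFDerivWithinAt_fderivWithin hd h1) (hb q hq h2)
      (fun p hp hs => fderivWithin_eq_on_exit hd1 hf hc hp hs) ?_
    -- `flowDeriv f₀` agrees with its reflection on the boundary, so its gradient can be matched by
    -- the same transversality argument, the flow direction being supplied by the condition on
    -- `∇_{xx}`.
    have hg : fderivFlowDeriv f₀ q =
        (fderivFlowDeriv f₀ (billiard 1 q)).comp (fderiv ℝ (billiard 1) q) := by
      refine fderiv_eq_on_exit hq hs (hasFDerivWithinAt_flowDeriv hd h1)
        (hasFDerivWithinAt_comp_billiard hq (hasFDerivWithinAt_flowDeriv hd h2))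
        (fun p hp hs => (hc.flowDeriv_billiard hp hs).symm) ?_
      rw [ContinuousLinearMap.comp_apply, fderiv_billiard_flow 1 hq]
      exact (hxx.fderivFlowDeriv_billiard hd hq hs).symm
    -- By symmetry, the second derivative at `(v, 0)` and `η` is the derivative of `flowDeriv f₀`
    -- along `η` minus a first-order term; `hg` matches the former and the C¹ matching the latter.
    refine ContinuousLinearMap.ext fun η => ?_
    have e1 := congrArg (fun L => L η) hg
    have e2 := congrArg (fun L => L (η.2, 0)) (fderivWithin_eq_on_exit hd1 hf hc hq hs)
    simp only [ContinuousLinearMap.comp_apply, fderivFlowDeriv_apply] at e1 e2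
    rw [sndDeriv_symm hd h1]
    show _ = fderivWithin ℝ f₀ dataDomain (billiard 1 q)
        (fderiv ℝ (fderiv ℝ (billiard 1)) q (q.2, 0) η) +
      sndDeriv f₀ (billiard 1 q) (fderiv ℝ (billiard 1) q (q.2, 0)) (fderiv ℝ (billiard 1) q η)
    rw [fderiv_fderiv_billiard_flow 1 hq, fderiv_billiard_flow 1 hq, map_sub,
      sndDeriv_symm hd h2]
    linarith
  · intro q hq h
    have hB : ContinuousWithinAt (billiard 1) (billiard 1 ⁻¹' dataDomain) q :=
      (contDiffAt_billiard (n := 0) 1 hq).continuousAt.continuousWithinAt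
    have hB1 : ContinuousWithinAt (fderiv ℝ (billiard 1)) (billiard 1 ⁻¹' dataDomain) q :=
      (hasFDerivAt_fderiv_billiard 1 hq).continuousAt.continuousWithinAt
    have hB2 : ContinuousWithinAt (fderiv ℝ (fderiv ℝ (billiard 1)))
        (billiard 1 ⁻¹' dataDomain) q :=
      (((contDiffAt_billiard (n := 3) 1 hq).fderiv_right (m := 2) (by norm_num)).fderiv_right
        (m := 1) (by norm_num)).continuousAt.continuousWithinAt
    have hf1 := (hd1.continuousOn_fderivWithin uniqueDiffOn_dataDomain le_rfl _ h).comp hB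
      (mapsTo_preimage _ _)
    have hf2 := (continuousOn_sndDeriv hd _ h).comp hB (mapsTo_preimage _ _)
    refine ContinuousWithinAt.add ?_ ?_
    · exact ((ContinuousLinearMap.continuous _).continuousWithinAt.comp hf1
        (mapsTo_univ _ _)).clm_comp hB2
    · exact ((ContinuousLinearMap.continuous _).continuousWithinAt.comp hB1
        (mapsTo_univ _ _)).clm_comp (hf2.clm_comp hB1)

/-- Regularity at the incoming boundary spreads to all lines meeting the disk. -/
lemma contDiffAt_unfolded_of_exitStrip {n : WithTop ℕ∞} (h : ContDiffOn ℝ n (unfolded f₀) exitStrip)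
    {q : Plane × Plane} (hq : q ∈ chordSet) : ContDiffAt ℝ n (unfolded f₀) q := by
  have hσ := halfChord_pos hq
  -- The index is frozen at its value at `q`. Nearby points may have another index, but invariance
  -- holds for the fixed `k`.
  set k := foldIndex q
  have hmem : billiard k q ∈ exitStrip := by
    refine ⟨billiard_mem_chordSet k hq, ?_⟩
    rw [along_billiard k hq.1, halfChord_billiard]
    have := foldIndex_spec hq
    constructor <;> linarith
  have h1 := ((h _ hmem).contDiffAt (isOpen_exitStrip.mem_nhds hmem)).comp q
    (contDiffAt_billiard k hq)
  refine h1.congr_of_eventuallyEq ?_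
  filter_upwards [isOpen_chordSet.mem_nhds hq] with p hp using (unfolded_billiard f₀ k hp).symm

/-- This covers `v = 0`, where chord coordinates are not available. -/
lemma contDiffAt_unfolded_of_norm_lt {n : WithTop ℕ∞} (hd : ContDiffOn ℝ n f₀ dataDomain)
    (hf : SpecularData f₀) {q : Plane × Plane} (hq : ‖q.1‖ < 1) :
    ContDiffAt ℝ n (unfolded f₀) q := by
  have hev : ∀ᶠ p : Plane × Plane in nhds q, ‖p.1‖ < 1 :=
    continuous_fst.norm.continuousAt.eventually_lt continuousAt_const hq
  have h1 : dataDomain ∈ nhds q := hev.mono fun p hp => mem_dataDomain_iff.2 hp.le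
  exact (hd.contDiffAt h1).congr_of_eventuallyEq (hev.mono fun p hp => unfolded_eq_of_norm_lt hf hp)

end regularity

/-! ### Bounds for derivatives of order at most two -/

section jets

variable {E F G H : Type*} [NormedAddCommGroup E] [NormedSpace ℝ E] [NormedAddCommGroup F]
  [NormedSpace ℝ F] [NormedAddCommGroup G] [NormedSpace ℝ G] [NormedAddCommGroup H]
  [NormedSpace ℝ H]

/-- Bounds for a function and its derivatives of order one and two at a point. -/
structure JetBound (f : E → F) (p : E) (a b c : ℝ) : Prop where
  smooth : ContDiffAt ℝ 2 f p
  zero : ‖f p‖ ≤ a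
  one : ‖fderiv ℝ f p‖ ≤ b
  two : ‖iteratedFDeriv ℝ 2 f p‖ ≤ c

lemma norm_iteratedFDeriv_two (f : E → F) (p : E) :
    ‖iteratedFDeriv ℝ 2 f p‖ = ‖fderiv ℝ (fderiv ℝ f) p‖ := by
  rw [← norm_iteratedFDeriv_one, norm_iteratedFDeriv_fderiv]

lemma differentiableAt_fderiv {f : E → F} {p : E} (h : ContDiffAt ℝ 2 f p) :
    DifferentiableAt ℝ (fderiv ℝ f) p :=
  (h.fderiv_right (m := 1) (by norm_num)).differentiableAt one_ne_zero

namespace JetBound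

variable {f g : E → F} {p : E} {a b c a' b' c' : ℝ}

lemma mono (h : JetBound f p a b c) (ha : a ≤ a') (hb : b ≤ b') (hc : c ≤ c') :
    JetBound f p a' b' c' :=
  ⟨h.smooth, h.zero.trans ha, h.one.trans hb, h.two.trans hc⟩

lemma with_zero (h : JetBound f p a b c) (ha : ‖f p‖ ≤ a') : JetBound f p a' b c :=
  ⟨h.smooth, ha, h.one, h.two⟩

lemma nonneg (h : JetBound f p a b c) : 0 ≤ a ∧ 0 ≤ b ∧ 0 ≤ c :=
  ⟨(norm_nonneg _).trans h.zero, (norm_nonneg _).trans h.one, (norm_nonneg _).trans h.two⟩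

lemma const (y : F) (p : E) : JetBound (fun _ : E => y) p ‖y‖ 0 0 :=
  ⟨contDiffAt_const, le_rfl, by simp, by simp [iteratedFDeriv_const_of_ne two_ne_zero]⟩

lemma clm (L : E →L[ℝ] F) (hL : ‖L‖ ≤ 1) (p : E) : JetBound L p ‖L p‖ 1 0 := by
  refine ⟨L.contDiff.contDiffAt, le_rfl, by simpa using hL, ?_⟩
  have : fderiv ℝ L = fun _ => L := by ext1 x; exact L.fderiv
  rw [← norm_iteratedFDeriv_fderiv, this, iteratedFDeriv_const_of_ne one_ne_zero]; simp

lemma add (hf : JetBound f p a b c) (hg : JetBound g p a' b' c') :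
    JetBound (fun q => f q + g q) p (a + a') (b + b') (c + c') := by
  refine ⟨hf.smooth.add hg.smooth, norm_add_le_of_le hf.zero hg.zero, ?_, ?_⟩
  · rw [fderiv_fun_add (hf.smooth.differentiableAt two_ne_zero)
      (hg.smooth.differentiableAt two_ne_zero)]
    exact norm_add_le_of_le hf.one hg.one
  · have h := iteratedFDeriv_add_apply (i := 2) hf.smooth hg.smooth
    refine (congrArg norm h).trans_le ?_
    exact norm_add_le_of_le hf.two hg.two

lemma prodMk {g : E → G} (hf : JetBound f p a b c) (hg : JetBound g p a' b c) :
    JetBound (fun q => (f q, g q)) p (max a a') b c := by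
  refine ⟨hf.smooth.prodMk hg.smooth, max_le_max hf.zero hg.zero, ?_, ?_⟩
  · rw [(hf.smooth.differentiableAt two_ne_zero).fderiv_prodMk
      (hg.smooth.differentiableAt two_ne_zero), ContinuousLinearMap.opNorm_prod]
    exact max_le hf.one hg.one
  · rw [iteratedFDeriv_prodMk hf.smooth hg.smooth le_rfl, ContinuousMultilinearMap.opNorm_prod]
    exact max_le hf.two hg.two

lemma bilinear (B : F →L[ℝ] G →L[ℝ] H) (hB : ‖B‖ ≤ 1) {g : E → G} (hf : JetBound f p a b c)
    (hg : JetBound g p a' b' c') :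
    JetBound (fun q => B (f q) (g q)) p (a * a') (a * b' + b * a')
      (a * c' + 2 * b * b' + c * a') := by
  have hsm : ContDiffAt ℝ 2 (fun q => B (f q) (g q)) p :=
    (B.isBoundedBilinearMap.contDiff (n := 2)).contDiffAt.comp p (hf.smooth.prodMk hg.smooth)
  obtain ⟨u, hu, hou, hpu⟩ := mem_nhds_iff.1
    ((hf.smooth.eventually (by simp)).and (hg.smooth.eventually (by simp)))
  have hfu : ContDiffOn ℝ 2 f u := fun q hq => (hu hq).1.contDiffWithinAt
  have hgu : ContDiffOn ℝ 2 g u := fun q hq => (hu hq).2.contDiffWithinAt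
  have key : ∀ n : ℕ, (n : WithTop ℕ∞) ≤ 2 → ‖iteratedFDeriv ℝ n (fun q => B (f q) (g q)) p‖ ≤
      ∑ i ∈ Finset.range (n + 1),
        (n.choose i : ℝ) * ‖iteratedFDeriv ℝ i f p‖ * ‖iteratedFDeriv ℝ (n - i) g p‖ := by
    intro n hn
    have := B.norm_iteratedFDerivWithin_le_of_bilinear_of_le_one hfu hgu hou.uniqueDiffOn hpu hn hB
    simpa only [iteratedFDerivWithin_of_isOpen _ hou hpu] using this
  obtain ⟨ha, hb, hc⟩ := hf.nonneg
  obtain ⟨ha', hb', hc'⟩ := hg.nonneg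
  refine ⟨hsm, ?_, ?_, ?_⟩
  · have := key 0 (by simp)
    simp at this
    exact this.trans (mul_le_mul hf.zero hg.zero (norm_nonneg _) ha)
  · have := key 1 (by norm_num)
    rw [norm_iteratedFDeriv_one] at this
    simp [Finset.sum_range_succ, norm_iteratedFDeriv_one] at this
    exact this.trans (add_le_add (mul_le_mul hf.zero hg.one (norm_nonneg _) ha)
      (mul_le_mul hf.one hg.zero (norm_nonneg _) hb))
  · have := key 2 (by norm_num)
    simp [Finset.sum_range_succ, norm_iteratedFDeriv_one] at this
    refine this.trans (add_le_add (add_le_add (mul_le_mul hf.zero hg.two (norm_nonneg _) ha) ?_)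
      (mul_le_mul hf.two hg.zero (norm_nonneg _) hc))
    rw [mul_assoc, mul_assoc]
    exact mul_le_mul_of_nonneg_left (mul_le_mul hf.one hg.one (norm_nonneg _) hb) zero_le_two

lemma smul {f : E → ℝ} {g : E → G} (hf : JetBound f p a b c) (hg : JetBound g p a' b' c') :
    JetBound (fun q => f q • g q) p (a * a') (a * b' + b * a') (a * c' + 2 * b * b' + c * a') :=
  hf.bilinear (ContinuousLinearMap.lsmul ℝ ℝ) ContinuousLinearMap.opNorm_lsmul_le hg

lemma const_smul (k : ℝ) (hf : JetBound f p a b c) :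
    JetBound (fun q => k • f q) p (|k| * a) (|k| * b) (|k| * c) := by
  simpa using (JetBound.const k p).smul hf

lemma comp {g : F → G} (hg : JetBound g (f p) a' b' c') (hf : JetBound f p a b c) :
    JetBound (fun q => g (f q)) p a' (b' * b) (c' * b ^ 2 + b' * c) := by
  obtain ⟨ha, hb, hc⟩ := hf.nonneg
  obtain ⟨ha', hb', hc'⟩ := hg.nonneg
  have hfd := (hf.smooth.differentiableAt two_ne_zero)
  have hgd := (hg.smooth.differentiableAt two_ne_zero)
  refine ⟨hg.smooth.comp p hf.smooth, hg.zero, ?_, ?_⟩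
  · rw [fderiv_fun_comp p hgd hfd]
    exact (ContinuousLinearMap.opNorm_comp_le _ _).trans
      (mul_le_mul hg.one hf.one (norm_nonneg _) hb')
  · have h : fderiv ℝ (fun q => g (f q)) =ᶠ[nhds p]
        fun q => (fderiv ℝ g (f q)).comp (fderiv ℝ f q) := by
      filter_upwards [hf.smooth.eventually (by simp),
        hf.smooth.continuousAt.eventually (hg.smooth.eventually (by simp))] with q h1 h2
      exact fderiv_fun_comp q (h2.differentiableAt two_ne_zero) (h1.differentiableAt two_ne_zero)
    have hf2 := (norm_iteratedFDeriv_two f p).symm.trans_le hf.two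
    have hg2 := (norm_iteratedFDeriv_two g (f p)).symm.trans_le hg.two
    have h2 := ((differentiableAt_fderiv hg.smooth).hasFDerivAt.comp p hfd.hasFDerivAt).clm_comp
      (differentiableAt_fderiv hf.smooth).hasFDerivAt
    rw [norm_iteratedFDeriv_two, h.fderiv_eq]
    erw [h2.fderiv]
    refine ContinuousLinearMap.opNorm_le_bound _ (by positivity) fun η => ?_
    refine (norm_add_le _ _).trans ?_
    have e1 : ‖(fderiv ℝ g (f p)).comp (fderiv ℝ (fderiv ℝ f) p η)‖ ≤ b' * (c * ‖η‖) :=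
      (ContinuousLinearMap.opNorm_comp_le _ _).trans
        (mul_le_mul hg.one (ContinuousLinearMap.le_of_opNorm_le _ hf2 η) (norm_nonneg _) hb')
    have e2 : ‖(fderiv ℝ (fderiv ℝ g) (f p) (fderiv ℝ f p η)).comp (fderiv ℝ f p)‖ ≤
        (c' * (b * ‖η‖)) * b := by
      refine (ContinuousLinearMap.opNorm_comp_le _ _).trans
        (mul_le_mul ?_ hf.one (norm_nonneg _) (by positivity))
      exact (ContinuousLinearMap.le_of_opNorm_le _ hg2 _).trans
        (mul_le_mul_of_nonneg_left (ContinuousLinearMap.le_of_opNorm_le _ hf.one η) hc')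
    refine (add_le_add e1 e2).trans (le_of_eq ?_)
    ring

lemma of_hasDerivAt {h h₁ : ℝ → ℝ} {h₂ x : ℝ} (hs : ContDiffAt ℝ 2 h x)
    (h1 : ∀ᶠ y in nhds x, HasDerivAt h (h₁ y) y) (h2 : HasDerivAt h₁ h₂ x) :
    JetBound h x |h x| |h₁ x| |h₂| := by
  refine ⟨hs, le_rfl, ?_, ?_⟩
  · rw [← norm_deriv_eq_norm_fderiv, h1.self_of_nhds.deriv, Real.norm_eq_abs]
  · rw [norm_iteratedFDeriv_eq_norm_iteratedDeriv, iteratedDeriv_succ,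
      iteratedDeriv_one]
    have : deriv h =ᶠ[nhds x] h₁ := h1.mono fun y hy => hy.deriv
    rw [this.deriv_eq, h2.deriv, Real.norm_eq_abs]

end JetBound

end jets

/-! ### Derivative bounds for the reflected motion -/

section

variable {E : Type*} [NormedAddCommGroup E] [NormedSpace ℝ E] {p : E} {a b c a' b' c' : ℝ}

lemma JetBound.inner {f g : E → Plane} (hf : JetBound f p a b c) (hg : JetBound g p a' b' c') :
    JetBound (fun q => (inner ℝ (f q) (g q) : ℝ)) p (a * a') (a * b' + b * a')
      (a * c' + 2 * b * b' + c * a') :=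
  hf.bilinear (LinearMap.mkContinuous₂ (innerₗ Plane) 1
      fun x y => by simpa using norm_inner_le_norm (𝕜 := ℝ) x y)
    (LinearMap.mkContinuous₂_norm_le _ zero_le_one _) hg

lemma JetBound.comp_perp {f : E → Plane} (hf : JetBound f p a b c) :
    JetBound (fun q => perp (f q)) p a b c := by
  have hp : ‖perp‖ ≤ 1 := perp.opNorm_le_bound zero_le_one fun v => by simp
  have := (JetBound.clm perp hp (f p)).comp hf
  simp only [one_mul, zero_mul, zero_add, norm_perp] at this
  exact this.mono hf.zero le_rfl le_rfl

lemma JetBound.cos {f : E → ℝ} (hf : JetBound f p a b c) :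
    JetBound (fun q => Real.cos (f q)) p 1 b (b ^ 2 + c) := by
  have h := JetBound.of_hasDerivAt (x := f p) Real.contDiff_cos.contDiffAt
    (Filter.Eventually.of_forall fun y => Real.hasDerivAt_cos y) (Real.hasDerivAt_sin _).neg
  have h' := h.mono (Real.abs_cos_le_one _) (a' := 1) (b' := 1) (c' := 1)
    (by simpa using Real.abs_sin_le_one _) (by simpa using Real.abs_cos_le_one _)
  simpa using h'.comp hf

lemma JetBound.sin {f : E → ℝ} (hf : JetBound f p a b c) :
    JetBound (fun q => Real.sin (f q)) p 1 b (b ^ 2 + c) := by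
  have h := JetBound.of_hasDerivAt (x := f p) Real.contDiff_sin.contDiffAt
    (Filter.Eventually.of_forall fun y => Real.hasDerivAt_sin y) (Real.hasDerivAt_cos _)
  have h' := h.mono (Real.abs_sin_le_one _) (a' := 1) (b' := 1) (c' := 1)
    (Real.abs_cos_le_one _) (by simpa using Real.abs_sin_le_one _)
  simpa using h'.comp hf

/-- Write `‖v‖⁻¹` as `r ↦ r ^ (-1/2)` applied to `‖v‖ ^ 2`. The constant is `4 = 3 + 1`, from the
two terms of the second-order chain rule. -/
lemma jetBound_inv_norm {v : Plane} (hv : v ≠ 0) :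
    JetBound (fun v : Plane => ‖v‖⁻¹) v ‖v‖⁻¹ (‖v‖⁻¹ ^ 2) (4 * ‖v‖⁻¹ ^ 3) := by
  have hρ : 0 < ‖v‖ := norm_pos_iff.2 hv
  have hid := JetBound.clm (ContinuousLinearMap.id ℝ Plane) ContinuousLinearMap.norm_id_le v
  have hsq := hid.inner hid
  have hd : ∀ r : ℝ, 0 < r → HasDerivAt (fun r => (√r)⁻¹) (-(1 / 2) * (√r)⁻¹ ^ 3) r := by
    intro r hr
    refine ((Real.hasDerivAt_sqrt hr.ne').inv (Real.sqrt_pos.2 hr).ne').congr_deriv ?_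
    have := (Real.sqrt_pos.2 hr).ne'
    field_simp
  have hr : (0 : ℝ) < inner ℝ v v := by rw [real_inner_self_eq_norm_sq]; positivity
  have hd2 := ((hd _ hr).pow 3).const_mul (-(1 / 2))
  have hsm : ContDiffAt ℝ 2 (fun r : ℝ => (√r)⁻¹) (inner ℝ v v) :=
    (Real.contDiffAt_sqrt hr.ne').inv (Real.sqrt_pos.2 hr).ne'
  have h := JetBound.of_hasDerivAt hsm ((lt_mem_nhds hr).mono fun y hy => hd y hy) hd2
  have h2 := JetBound.comp (f := fun w : Plane => (inner ℝ w w : ℝ)) h hsq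
  have hs : √(inner ℝ v v : ℝ) = ‖v‖ := by
    rw [real_inner_self_eq_norm_sq, Real.sqrt_sq hρ.le]
  have heq : (fun w : Plane => (√(inner ℝ w w : ℝ))⁻¹) = fun w => ‖w‖⁻¹ := by
    ext w; rw [real_inner_self_eq_norm_sq, Real.sqrt_sq (norm_nonneg _)]
  rw [heq] at h2
  rw [hs] at h2
  refine h2.mono ?_ ?_ ?_
  · rw [abs_of_pos (by positivity)]
  · simp [abs_of_pos hρ]
    refine le_of_eq ?_
    field_simp; norm_num
  · simp [abs_of_pos hρ]
    refine le_of_eq ?_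
    field_simp; norm_num

/-! ### Jet bounds for the chord coordinates -/

variable {q : Plane × Plane}

lemma jetBound_fst (q : Plane × Plane) :
    JetBound (fun q : Plane × Plane => q.1) q ‖q.1‖ 1 0 :=
  JetBound.clm (ContinuousLinearMap.fst ℝ Plane Plane) (ContinuousLinearMap.norm_fst_le ..) q

lemma jetBound_snd (q : Plane × Plane) :
    JetBound (fun q : Plane × Plane => q.2) q ‖q.2‖ 1 0 :=
  JetBound.clm (ContinuousLinearMap.snd ℝ Plane Plane) (ContinuousLinearMap.norm_snd_le ..) q

lemma jetBound_inv_norm_snd (hv : q.2 ≠ 0) :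
    JetBound (fun q : Plane × Plane => ‖q.2‖⁻¹) q ‖q.2‖⁻¹ (‖q.2‖⁻¹ ^ 2) (4 * ‖q.2‖⁻¹ ^ 3) := by
  simpa using (jetBound_inv_norm hv).comp (jetBound_snd q)

lemma jetBound_direction (hv : q.2 ≠ 0) :
    JetBound (fun q : Plane × Plane => ‖q.2‖⁻¹ • q.2) q 1 (2 * ‖q.2‖⁻¹) (6 * ‖q.2‖⁻¹ ^ 2) := by
  have hρ : ‖q.2‖ ≠ 0 := norm_ne_zero_iff.2 hv
  refine ((jetBound_inv_norm_snd hv).smul (jetBound_snd q)).mono ?_ ?_ ?_ <;>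
    refine le_of_eq ?_ <;> field_simp <;> norm_num

lemma jetBound_impact (hq : q ∈ chordSet) (hx : ‖q.1‖ ≤ 1) :
    JetBound impact q 1 (2 * (1 + ‖q.2‖⁻¹)) (6 * (1 + ‖q.2‖⁻¹) ^ 2) := by
  have hρ : 0 < ‖q.2‖ := norm_pos_iff.2 hq.1
  have h1 := ((jetBound_fst q).with_zero hx).inner (jetBound_snd q).comp_perp
  have h2 := (jetBound_inv_norm_snd hq.1).smul h1
  have heq : (fun q : Plane × Plane => ‖q.2‖⁻¹ • (inner ℝ q.1 (perp q.2) : ℝ)) = impact := by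
    ext q; rw [impact, smul_eq_mul, div_eq_inv_mul]
  rw [heq] at h2
  have hr : 0 < ‖q.2‖⁻¹ := by positivity
  have hrρ : ‖q.2‖⁻¹ * ‖q.2‖ = 1 := inv_mul_cancel₀ hρ.ne'
  refine (h2.with_zero hq.2.le).mono le_rfl ?_ ?_
  · have : ‖q.2‖⁻¹ * (1 * 1 + 1 * ‖q.2‖) + ‖q.2‖⁻¹ ^ 2 * (1 * ‖q.2‖) = 1 + 2 * ‖q.2‖⁻¹ := by
      linear_combination (1 + ‖q.2‖⁻¹) * hrρ
    rw [this]; linarith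
  · have : ‖q.2‖⁻¹ * (1 * 0 + 2 * 1 * 1 + 0 * ‖q.2‖) + 2 * ‖q.2‖⁻¹ ^ 2 * (1 * 1 + 1 * ‖q.2‖)
        + 4 * ‖q.2‖⁻¹ ^ 3 * (1 * ‖q.2‖) = 4 * ‖q.2‖⁻¹ + 6 * ‖q.2‖⁻¹ ^ 2 := by
      linear_combination (4 * ‖q.2‖⁻¹ ^ 2 + 2 * ‖q.2‖⁻¹) * hrρ
    rw [this]
    nlinarith

lemma hasDerivAt_sqrt_one_sub_sq {b : ℝ} (hb : b ^ 2 < 1) :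
    HasDerivAt (fun b : ℝ => √(1 - b ^ 2)) (-b / √(1 - b ^ 2)) b := by
  have h := (((hasDerivAt_id b).pow 2).const_sub 1).sqrt (by simp only [id, Pi.pow_apply]; linarith)
  refine h.congr_deriv ?_
  simp only [id, Pi.pow_apply]
  have : √(1 - b ^ 2) ≠ 0 := (Real.sqrt_pos.2 (by linarith)).ne'
  field_simp
  norm_num

lemma eventually_sq_lt_one {b : ℝ} (hb : b ^ 2 < 1) : ∀ᶠ y : ℝ in nhds b, y ^ 2 < 1 :=
  (continuous_pow 2).continuousAt.eventually_lt continuousAt_const hb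

lemma jetBound_sqrt_one_sub_sq {b : ℝ} (hb : b ^ 2 < 1) :
    JetBound (fun b : ℝ => √(1 - b ^ 2)) b √(1 - b ^ 2) (√(1 - b ^ 2))⁻¹ ((√(1 - b ^ 2))⁻¹ ^ 3) := by
  have hσ : 0 < √(1 - b ^ 2) := Real.sqrt_pos.2 (by linarith)
  have hσ2 : √(1 - b ^ 2) ^ 2 = 1 - b ^ 2 := Real.sq_sqrt (by linarith)
  have h2 := (hasDerivAt_neg b).div (hasDerivAt_sqrt_one_sub_sq hb) hσ.ne'
  have hsm : ContDiffAt ℝ 2 (fun b : ℝ => √(1 - b ^ 2)) b :=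
    (contDiffAt_const.sub (contDiffAt_id.pow 2)).sqrt (by simp only [id]; linarith)
  have h := JetBound.of_hasDerivAt hsm
    ((eventually_sq_lt_one hb).mono fun y hy => hasDerivAt_sqrt_one_sub_sq hy) h2
  refine h.mono (abs_of_pos hσ).le ?_ ?_
  · rw [abs_div, abs_neg, abs_of_pos hσ, div_eq_mul_inv]
    have := (sq_lt_one_iff_abs_lt_one b).1 hb
    exact mul_le_of_le_one_left (by positivity) this.le
  · refine le_of_eq ?_
    have : (-1 * √(1 - b ^ 2) - -b * (-b / √(1 - b ^ 2))) / √(1 - b ^ 2) ^ 2 =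
        -(√(1 - b ^ 2))⁻¹ ^ 3 := by
      field_simp
      rw [hσ2]; ring
    rw [this, abs_neg, abs_of_pos (by positivity)]

lemma jetBound_arcsin {b : ℝ} (hb : b ^ 2 < 1) :
    JetBound Real.arcsin b |Real.arcsin b| (√(1 - b ^ 2))⁻¹ ((√(1 - b ^ 2))⁻¹ ^ 3) := by
  have hσ : 0 < √(1 - b ^ 2) := Real.sqrt_pos.2 (by linarith)
  have hne : ∀ y : ℝ, y ^ 2 < 1 → y ≠ -1 ∧ y ≠ 1 := by
    intro y hy
    constructor <;> rintro rfl <;> norm_num at hy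
  have h2 := (hasDerivAt_const b (1 : ℝ)).div (hasDerivAt_sqrt_one_sub_sq hb) hσ.ne'
  have h := JetBound.of_hasDerivAt (Real.contDiffAt_arcsin (hne b hb).1 (hne b hb).2)
    ((eventually_sq_lt_one hb).mono fun y hy => Real.hasDerivAt_arcsin (hne y hy).1 (hne y hy).2) h2
  refine h.mono le_rfl ?_ ?_
  · rw [abs_of_pos (by positivity), one_div]
  · have : (0 * √(1 - b ^ 2) - 1 * (-b / √(1 - b ^ 2))) / √(1 - b ^ 2) ^ 2 =
        b * (√(1 - b ^ 2))⁻¹ ^ 3 := by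
      field_simp; ring
    rw [this, abs_mul, abs_of_pos (show 0 < (√(1 - b ^ 2))⁻¹ ^ 3 by positivity)]
    have := (sq_lt_one_iff_abs_lt_one b).1 hb
    exact mul_le_of_le_one_left (by positivity) this.le

/-- `√(1 - b ^ 2)` and `arcsin` have derivatives bounded by the same powers of `1/σ`, so they share
one chain rule; `10 = 4 + 6`, using `σ⁻¹ ≤ σ⁻¹ ^ 3`. -/
lemma JetBound.comp_impact {h : ℝ → ℝ} {a : ℝ} (hq : q ∈ chordSet) (hx : ‖q.1‖ ≤ 1)
    (hh : JetBound h (impact q) a (halfChord q)⁻¹ ((halfChord q)⁻¹ ^ 3)) :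
    JetBound (fun q => h (impact q)) q a (2 * ((halfChord q)⁻¹ * (1 + ‖q.2‖⁻¹)))
      (10 * ((halfChord q)⁻¹ ^ 3 * (1 + ‖q.2‖⁻¹) ^ 2)) := by
  refine (hh.comp (jetBound_impact hq hx)).mono le_rfl (le_of_eq (by ring)) ?_
  have hσ := halfChord_pos hq
  have h1 : 1 ≤ (halfChord q)⁻¹ := (one_le_inv₀ hσ).2 (halfChord_le_one q)
  have h3 : (halfChord q)⁻¹ ≤ (halfChord q)⁻¹ ^ 3 := le_self_pow₀ h1 (by norm_num)
  have := mul_le_mul_of_nonneg_right h3 (sq_nonneg (1 + ‖q.2‖⁻¹))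
  linarith

lemma jetBound_halfChord (hq : q ∈ chordSet) (hx : ‖q.1‖ ≤ 1) :
    JetBound halfChord q (halfChord q) (2 * ((halfChord q)⁻¹ * (1 + ‖q.2‖⁻¹)))
      (10 * ((halfChord q)⁻¹ ^ 3 * (1 + ‖q.2‖⁻¹) ^ 2)) :=
  (jetBound_sqrt_one_sub_sq ((sq_lt_one_iff_abs_lt_one _).2 hq.2)).comp_impact hq hx

lemma jetBound_arcsin_impact (hq : q ∈ chordSet) (hx : ‖q.1‖ ≤ 1) :
    JetBound (fun q => Real.arcsin (impact q)) q |Real.arcsin (impact q)|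
      (2 * ((halfChord q)⁻¹ * (1 + ‖q.2‖⁻¹)))
      (10 * ((halfChord q)⁻¹ ^ 3 * (1 + ‖q.2‖⁻¹) ^ 2)) :=
  (jetBound_arcsin ((sq_lt_one_iff_abs_lt_one _).2 hq.2)).comp_impact hq hx

end

/-- The free backward motion over the time `p.1`, followed by `k` reflections. -/
def rewind (k : ℤ) (p : ℝ × Plane × Plane) : Plane × Plane :=
  billiard k (p.2.1 + (-p.1) • p.2.2, p.2.2)

/-- The growth rate of the derivatives of the reflected motion. -/
def growth (p : ℝ × Plane × Plane) : ℝ :=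
  (1 + ‖p.2.2‖ * p.1) * (halfChord p.2)⁻¹ ^ 2 * (1 + ‖p.2.2‖⁻¹)

/-- Angle and chord are those of `(x, v)` itself, so the time enters only through the displacement
`-t v`. -/
lemma rewind_eq (k : ℤ) (p : ℝ × Plane × Plane) :
    rewind k p = (rot (k * deflection p.2) (p.2.1 + (-p.1) • p.2.2 +
        (2 * k : ℝ) • (halfChord p.2 • (‖p.2.2‖⁻¹ • p.2.2))), rot (k * deflection p.2) p.2.2) := by
  obtain ⟨t, x, v⟩ := p
  simp only [rewind, billiard, halfChord, deflection, impact_shift, smul_smul, div_eq_mul_inv,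
    mul_assoc]

/-! ### Jet bounds for the rewound motion -/

section bounds

variable {p : ℝ × Plane × Plane}

lemma one_le_growth (hq : p.2 ∈ chordSet) (ht : 0 ≤ p.1) : 1 ≤ growth p := by
  have hs : 1 ≤ (halfChord p.2)⁻¹ := (one_le_inv₀ (halfChord_pos hq)).2 (halfChord_le_one _)
  have hT : 1 ≤ 1 + ‖p.2.2‖ * p.1 := by linarith [mul_nonneg (norm_nonneg p.2.2) ht]
  have hm : 1 ≤ 1 + ‖p.2.2‖⁻¹ := by linarith [inv_nonneg.2 (norm_nonneg p.2.2)]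
  exact one_le_mul_of_one_le_of_one_le (one_le_mul_of_one_le_of_one_le hT (one_le_pow₀ hs)) hm

/-- Everything rests on `k / σ ≤ (1 + |v| t) / σ ^ 2`, the bound on the number of bounces divided by
`σ ^ 2`. -/
lemma growth_bounds (hq : p.2 ∈ chordSet) (ht : 0 ≤ p.1) {k : ℕ}
    (hk : k * halfChord p.2 ≤ 1 + ‖p.2.2‖ * p.1) :
    k * ((halfChord p.2)⁻¹ * (1 + ‖p.2.2‖⁻¹)) ≤ growth p ∧
    k * ((halfChord p.2)⁻¹ ^ 3 * (1 + ‖p.2.2‖⁻¹) ^ 2) ≤ growth p ^ 2 ∧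
    k * halfChord p.2 * ‖p.2.2‖⁻¹ ≤ growth p ∧
    ‖p.2.2‖⁻¹ ≤ growth p ∧ p.1 ≤ growth p := by
  have hσ := halfChord_pos hq
  have hρ : 0 < ‖p.2.2‖ := norm_pos_iff.2 hq.1
  have hs : 1 ≤ (halfChord p.2)⁻¹ := (one_le_inv₀ hσ).2 (halfChord_le_one _)
  have hσs : halfChord p.2 * (halfChord p.2)⁻¹ = 1 := mul_inv_cancel₀ hσ.ne'
  have hρr : ‖p.2.2‖ * ‖p.2.2‖⁻¹ = 1 := mul_inv_cancel₀ hρ.ne'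
  have hT : 1 ≤ 1 + ‖p.2.2‖ * p.1 := by linarith [mul_nonneg hρ.le ht]
  have hr : 0 < ‖p.2.2‖⁻¹ := by positivity
  rw [growth]
  set σ := halfChord p.2
  set s := σ⁻¹
  set r := ‖p.2.2‖⁻¹
  set T := 1 + ‖p.2.2‖ * p.1 with hTdef
  have hks : k * s ≤ T * s ^ 2 := by
    have := mul_le_mul_of_nonneg_right hk (sq_nonneg s)
    calc k * s = k * σ * s ^ 2 := by linear_combination (-(k : ℝ) * s) * hσs
      _ ≤ _ := this
  have hs2 : 1 ≤ s ^ 2 := one_le_pow₀ hs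
  have hT0 : 0 ≤ T := by linarith
  have hTs : T ≤ T * s ^ 2 := le_mul_of_one_le_right hT0 hs2
  have hTs1 : 1 ≤ T * s ^ 2 := hT.trans hTs
  refine ⟨?_, ?_, ?_, ?_, ?_⟩
  · calc k * (s * (1 + r)) = k * s * (1 + r) := by ring
      _ ≤ _ := mul_le_mul_of_nonneg_right hks (by positivity)
  · calc k * (s ^ 3 * (1 + r) ^ 2) = k * s * (s ^ 2 * (1 + r) ^ 2) := by ring
      _ ≤ T * s ^ 2 * (s ^ 2 * (1 + r) ^ 2) := mul_le_mul_of_nonneg_right hks (by positivity)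
      _ ≤ T * s ^ 2 * (T * s ^ 2 * (1 + r) ^ 2) := by
          gcongr; exact le_mul_of_one_le_left (sq_nonneg s) hT
      _ = _ := by ring
  · calc k * σ * r ≤ (T * s ^ 2) * (1 + r) := by
          refine mul_le_mul (hk.trans hTs) (by linarith) hr.le (by positivity)
      _ = _ := by ring
  · calc r ≤ 1 * (1 + r) := by linarith
      _ ≤ _ := mul_le_mul_of_nonneg_right hTs1 (by positivity)
  · calc p.1 = (‖p.2.2‖ * p.1) * r := by linear_combination (-p.1) * hρr
      _ ≤ (T * s ^ 2) * (1 + r) := by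
          refine mul_le_mul (by linarith) (by linarith) hr.le (by positivity)
      _ = _ := by ring

lemma JetBound.comp_snd {F : Type*} [NormedAddCommGroup F] [NormedSpace ℝ F]
    {g : Plane × Plane → F} {a b c : ℝ} (hg : JetBound g p.2 a b c) :
    JetBound (fun p : ℝ × Plane × Plane => g p.2) p a b c := by
  have hs := JetBound.clm (ContinuousLinearMap.snd ℝ ℝ (Plane × Plane))
    (ContinuousLinearMap.norm_snd_le ..) p
  simpa using hg.comp hs

/-- No value bound is recorded: the angle enters only through its sine and cosine. -/
lemma jetBound_angle (hq : p.2 ∈ chordSet) (hx : ‖p.2.1‖ ≤ 1) (ht : 0 ≤ p.1) {k : ℕ}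
    (hk : k * halfChord p.2 ≤ 1 + ‖p.2.2‖ * p.1) :
    ∃ a, JetBound (fun p : ℝ × Plane × Plane => (k : ℝ) * deflection p.2) p a
      (4 * growth p) (20 * growth p ^ 2) := by
  obtain ⟨h1, h2, -⟩ := growth_bounds hq ht hk
  have h := (JetBound.const ((k : ℝ) * Real.pi) p).add
    ((jetBound_arcsin_impact hq hx).comp_snd.const_smul (-2 * k))
  have heq : (fun p : ℝ × Plane × Plane => (k : ℝ) * Real.pi +
      (-2 * k : ℝ) • Real.arcsin (impact p.2)) = fun p => (k : ℝ) * deflection p.2 := by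
    ext p; rw [deflection, smul_eq_mul]; ring
  rw [heq] at h
  have habs : |(-2 * k : ℝ)| = 2 * k := by rw [abs_mul]; simp
  rw [habs] at h
  exact ⟨_, h.mono le_rfl (by linarith) (by linarith)⟩

lemma jetBound_rewind (hq : p.2 ∈ chordSet) (hx : ‖p.2.1‖ ≤ 1) (ht : 0 ≤ p.1) {k : ℕ}
    (hk : k * halfChord p.2 ≤ 1 + ‖p.2.2‖ * p.1) (hy : ‖(rewind k p).1‖ ≤ 1) :
    ∃ a, JetBound (rewind k) p a (28 * (growth p * (1 + ‖p.2.2‖)))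
      (332 * (growth p * (1 + ‖p.2.2‖)) ^ 2) := by
  obtain ⟨h1, h2, h3, h4, h5⟩ := growth_bounds hq ht hk
  obtain ⟨a, hθ⟩ := jetBound_angle hq hx ht hk
  have hβ := one_le_growth hq ht
  have hρ := norm_nonneg p.2.2
  have hσ := halfChord_pos hq
  have hr : 0 ≤ ‖p.2.2‖⁻¹ := inv_nonneg.2 hρ
  set β := growth p
  set ρ := ‖p.2.2‖
  set B := β * (1 + ρ) with hB
  have hβB : β ≤ B := by rw [hB]; nlinarith
  have hρB : ρ * β ≤ B := by rw [hB]; nlinarith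
  have hB1 : 1 ≤ B := hβ.trans hβB
  have hβ2 : β ^ 2 ≤ B ^ 2 := by gcongr
  have ht' : JetBound (fun p : ℝ × Plane × Plane => -p.1) p p.1 1 0 := by
    have h := JetBound.clm (-(ContinuousLinearMap.fst ℝ ℝ (Plane × Plane)))
      (by rw [norm_neg]; exact ContinuousLinearMap.norm_fst_le ..) p
    refine h.mono (le_of_eq ?_) le_rfl le_rfl
    simp [abs_of_nonneg ht]
  have hv : JetBound (fun p : ℝ × Plane × Plane => p.2.2) p ρ 1 0 := (jetBound_snd p.2).comp_snd
  have hP := (((jetBound_fst p.2).comp_snd.add (ht'.smul hv)).add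
    (((jetBound_halfChord hq hx).comp_snd.smul
      (jetBound_direction hq.1).comp_snd).const_smul (2 * k : ℝ)))
  -- The summands of the displaced position may be large, but their sum has norm at most one because
  -- the rotation is an isometry and the endpoint is in the disk. This keeps the derivatives of the
  -- rotation from meeting a factor growing in `t`.
  have hyP : ‖p.2.1 + (-p.1) • p.2.2 +
      (2 * k : ℝ) • (halfChord p.2 • (‖p.2.2‖⁻¹ • p.2.2))‖ ≤ 1 := by
    rw [rewind_eq] at hy
    simp only [norm_rot, Int.cast_natCast] at hy
    exact hy
  have hP' := (hP.with_zero hyP).mono (b' := 10 * B) (c' := 50 * B ^ 2) le_rfl (by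
      rw [abs_of_nonneg (by positivity)]
      nlinarith) (by
      rw [abs_of_nonneg (by positivity)]
      have e1 : k * halfChord p.2 * ρ⁻¹ * ρ⁻¹ ≤ β * β := mul_le_mul h3 h4 hr (by linarith)
      have e2 : k * ((halfChord p.2)⁻¹ * (1 + ρ⁻¹)) * ρ⁻¹ ≤ β * β := mul_le_mul h1 h4 hr (by linarith)
      nlinarith)
  have hcos := hθ.cos
  have hsin := hθ.sin
  have hX := (hcos.smul hP').add (hsin.smul hP'.comp_perp)
  have hV := (hcos.smul hv).add (hsin.smul hv.comp_perp)
  -- The product rule gives `28 = 2 * (10 + 4)` and `332 = 2 * (50 + 80 + 36)`, the factor 2 coming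
  -- from the cosine and sine terms.
  have hX' := hX.mono (b' := 28 * B) (c' := 332 * B ^ 2) le_rfl (by linarith) (by nlinarith)
  have hV' := hV.mono (b' := 28 * B) (c' := 332 * B ^ 2) le_rfl (by nlinarith) (by
    have e1 : β ^ 2 * ρ ≤ B ^ 2 := by
      rw [hB, mul_pow]; gcongr; nlinarith
    have e2 : β ≤ β ^ 2 := by nlinarith
    nlinarith)
  have hfin := hX'.prodMk hV'
  refine ⟨max (1 * 1 + 1 * 1) (1 * ρ + 1 * ρ), ?_⟩
  convert hfin using 1
  ext1 q
  rw [rewind_eq]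
  simp only [rot_apply, Int.cast_natCast]

end bounds

/-! ### The mild solution -/

lemma isClosed_grazing : IsClosed grazing := by
  refine IsClosed.inter (Metric.isClosed_sphere.preimage continuous_fst) ?_
  exact isClosed_eq (continuous_snd.inner continuous_fst) continuous_const

lemma uniqueDiffOn_timePhase : UniqueDiffOn ℝ timePhase :=
  (uniqueDiffOn_Ici 0).prod (uniqueDiffOn_dataDomain.inter isClosed_grazing.isOpen_compl)

/-- The free backward motion over the time `p.1`. -/
def freeMotion (p : ℝ × Plane × Plane) : Plane × Plane := (p.2.1 + (-p.1) • p.2.2, p.2.2)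

lemma contDiff_freeMotion {n : WithTop ℕ∞} : ContDiff ℝ n freeMotion := by
  unfold freeMotion; fun_prop

/-- Free motion may leave the disk but stays on a line meeting it; a particle at rest stays inside.
-/
lemma freeMotion_mem {p : ℝ × Plane × Plane} (hp : p ∈ timePhase) :
    freeMotion p ∈ chordSet ∨ ‖(freeMotion p).1‖ < 1 := by
  obtain ⟨t, x, v⟩ := p
  by_cases hv : v = 0
  · subst hv
    right
    simpa [freeMotion] using norm_lt_one_of_mem_phaseSpace hp.2
  · exact Or.inl (shift_mem_chordSet (mem_chordSet_of_mem_phaseSpace hp.2 hv) (-t))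

section solution

variable {f₀ : Plane × Plane → ℝ} {n : ℕ}

lemma eqOn_mildSol (hf : SpecularData f₀) :
    EqOn (mildSol f₀) (fun p => unfolded f₀ (freeMotion p)) timePhase := fun p hp =>
  mildSol_eq_unfolded (t := p.1) (x := p.2.1) (v := p.2.2) hf hp.1 hp.2

lemma contDiffAt_unfolded_freeMotion
    (hU : ∀ q, q ∈ chordSet ∨ ‖q.1‖ < 1 → ContDiffAt ℝ n (unfolded f₀) q)
    {p : ℝ × Plane × Plane} (hp : p ∈ timePhase) :
    ContDiffAt ℝ n (fun p => unfolded f₀ (freeMotion p)) p :=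
  (hU _ (freeMotion_mem hp)).comp p contDiff_freeMotion.contDiffAt

/-- At an incoming boundary point `(x, R_x v)` is `billiard 1 (x, v)`; this relation persists under
free motion, and `unfolded f₀` is invariant. -/
lemma mildSol_refl_of_incoming (hf : SpecularData f₀) {t : ℝ} (ht : 0 ≤ t) {x v : Plane}
    (h : (x, v) ∈ incoming) : mildSol f₀ (t, x, v) = mildSol f₀ (t, x, refl x v) := by
  have hx : ‖x‖ = 1 := mem_circ_iff.1 h.1
  have hv : v ≠ 0 := by rintro rfl; simpa using h.2
  have hin : (inner ℝ x v : ℝ) < 0 := by rw [real_inner_comm]; exact h.2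
  have hps : (x, v) ∈ phaseSpace :=
    ⟨mem_dataDomain_iff.2 hx.le, fun hg => absurd hg.2 h.2.ne⟩
  have hps' : (x, refl x v) ∈ phaseSpace := by
    refine ⟨mem_dataDomain_iff.2 hx.le, fun hg => ?_⟩
    have h1 : inner ℝ (refl x v) x = (0 : ℝ) := hg.2
    rw [real_inner_comm, inner_refl hx] at h1
    linarith
  have hq := mem_chordSet_of_mem_phaseSpace hps hv
  have hs : along (x, v) = -halfChord (x, v) := by
    have h1 : ‖x‖ ^ 2 = along (x, v) ^ 2 + impact (x, v) ^ 2 := norm_fst_sq (q := (x, v)) hv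
    have h2 : along (x, v) < 0 := div_neg_of_neg_of_pos hin (norm_pos_iff.2 hv)
    have h3 : along (x, v) ^ 2 = halfChord (x, v) ^ 2 := by
      rw [halfChord_sq hq]; rw [hx] at h1; linarith
    rcases sq_eq_sq_iff_eq_or_eq_neg.1 h3 with h4 | h4
    · linarith [halfChord_pos hq]
    · exact h4
  rw [mildSol_eq_unfolded hf ht hps, mildSol_eq_unfolded hf ht hps',
    ← unfolded_billiard f₀ 1 (shift_mem_chordSet hq (-t)), billiard_shift,
    billiard_one_of_along hq hs]

theorem isClassicalSol_mildSol (hn : n ≠ 0) (hf : SpecularData f₀)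
    (hU : ∀ q, q ∈ chordSet ∨ ‖q.1‖ < 1 → ContDiffAt ℝ n (unfolded f₀) q) :
    IsClassicalSol n f₀ (mildSol f₀) where
  contDiffOn := ContDiffOn.congr
    (fun p hp => (contDiffAt_unfolded_freeMotion hU hp).contDiffWithinAt) (eqOn_mildSol hf)
  transport := by
    intro t ht x hx v
    have hp : (t, x, v) ∈ timePhase :=
      ⟨ht, mem_dataDomain_iff.2 (mem_disk_iff.1 hx).le,
        fun hg => (mem_disk_iff.1 hx).ne (mem_circ_iff.1 hg.1)⟩
    have hd : DifferentiableAt ℝ (fun p => unfolded f₀ (freeMotion p)) (t, x, v) :=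
      (contDiffAt_unfolded_freeMotion hU hp).differentiableAt (by exact_mod_cast hn)
    rw [fderivWithin_congr (eqOn_mildSol hf) (eqOn_mildSol hf hp),
      hd.fderivWithin (uniqueDiffOn_timePhase _ hp)]
    have hline : HasDerivAt (fun c : ℝ => ((t + c, x + c • v, v) : ℝ × Plane × Plane))
        (1, v, 0) 0 := by
      have h1 := (hasDerivAt_id (0 : ℝ)).const_add t
      have h2 := ((hasDerivAt_id (0 : ℝ)).smul_const v).const_add x
      simpa using h1.prodMk (h2.prodMk (hasDerivAt_const (0 : ℝ) v))
    have hd0 : HasFDerivAt (fun p => unfolded f₀ (freeMotion p))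
        (fderiv ℝ (fun p => unfolded f₀ (freeMotion p)) (t, x, v))
        (t + 0, x + (0 : ℝ) • v, v) := by simpa using hd.hasFDerivAt
    have h1 := hd0.comp_hasDerivAt (0 : ℝ) hline
    -- `freeMotion` is constant along `c ↦ (t + c, x + c v, v)`.
    have h2 : ((fun p => unfolded f₀ (freeMotion p)) ∘
        fun c : ℝ => ((t + c, x + c • v, v) : ℝ × Plane × Plane)) =
        fun _ => unfolded f₀ (freeMotion (t, x, v)) := by
      ext c
      simp only [Function.comp_apply, freeMotion]
      congr 2
      module
    rw [h2] at h1
    exact h1.unique (hasDerivAt_const _ _)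
  specular := by
    intro t ht x hx v hg
    have hx1 := mem_circ_iff.1 hx
    rcases lt_trichotomy (inner ℝ v (normal x) : ℝ) 0 with h | h | h
    · exact mildSol_refl_of_incoming hf ht ⟨hx, h⟩
    · exact absurd ⟨hx, h⟩ hg
    · have hin : (x, refl x v) ∈ incoming := by
        refine ⟨hx, ?_⟩
        have h' : (0 : ℝ) < inner ℝ v x := h
        show inner ℝ (refl x v) x < (0 : ℝ)
        rw [real_inner_comm, inner_refl hx1, real_inner_comm]
        linarith
      rw [mildSol_refl_of_incoming hf ht hin, refl_refl hx1]
  initial := by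
    intro q hq
    obtain ⟨x, v⟩ := q
    rw [mildSol_eq_unfolded hf le_rfl hq]
    simp only [neg_zero, zero_smul, add_zero]
    by_cases hv : v = 0
    · subst hv; exact unfolded_zero f₀ x
    · exact unfolded_eq hf (mem_chordSet_of_mem_phaseSpace hq hv) (mem_dataDomain_iff.1 hq.1)

/-! ### Estimates -/

lemma jetNorm_eq_ofReal {E : Type*} [NormedAddCommGroup E] [NormedSpace ℝ E] (k : ℕ) (g : E → ℝ)
    (S : Set E) (p : E) : jetNorm k g S p =
      ENNReal.ofReal (∑ j ∈ Finset.range (k + 1), ‖iteratedFDerivWithin ℝ j g S p‖) := by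
  rw [jetNorm, ENNReal.ofReal_sum_of_nonneg fun _ _ => norm_nonneg _]
  simp only [ofReal_norm]

/-- `unfolded f₀` extends `f₀` smoothly past the boundary, so one-sided derivatives of the datum are
full derivatives of the extension. -/
lemma iteratedFDerivWithin_dataDomain_eq (hf : SpecularData f₀) {q : Plane × Plane}
    (hq : q ∈ chordSet) (hx : ‖q.1‖ ≤ 1) (hU : ContDiffAt ℝ n (unfolded f₀) q) {j : ℕ}
    (hj : j ≤ n) :
    iteratedFDerivWithin ℝ j f₀ dataDomain q = iteratedFDeriv ℝ j (unfolded f₀) q := by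
  have hqd : q ∈ dataDomain := mem_dataDomain_iff.2 hx
  have hev : f₀ =ᶠ[nhdsWithin q dataDomain] unfolded f₀ := by
    filter_upwards [self_mem_nhdsWithin, mem_nhdsWithin_of_mem_nhds (isOpen_chordSet.mem_nhds hq)]
      with p hp1 hp2 using (unfolded_eq hf hp2 (mem_dataDomain_iff.1 hp1)).symm
  rw [hev.iteratedFDerivWithin_eq (unfolded_eq hf hq hx).symm,
    iteratedFDerivWithin_eq_iteratedFDeriv uniqueDiffOn_dataDomain
      (hU.of_le (by exact_mod_cast hj)) hqd]

/-- The derivatives of the mild solution are those of the reflected datum. -/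
lemma exists_mildSol_jet (hf : SpecularData f₀)
    (hU : ∀ q, q ∈ chordSet ∨ ‖q.1‖ < 1 → ContDiffAt ℝ n (unfolded f₀) q)
    {t : ℝ} {x v : Plane} (ht : 0 ≤ t) (h : (x, v) ∈ phaseSpace) (hv : v ≠ 0) :
    ∃ k : ℤ, (∃ a, JetBound (rewind k) (t, x, v) a (28 * (growth (t, x, v) * (1 + ‖v‖)))
        (332 * (growth (t, x, v) * (1 + ‖v‖)) ^ 2)) ∧
      rewind k (t, x, v) ∈ chordSet ∧ ‖(rewind k (t, x, v)).1‖ ≤ 1 ∧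
      ∀ j ≤ n, iteratedFDerivWithin ℝ j (mildSol f₀) timePhase (t, x, v) =
        iteratedFDeriv ℝ j (fun p => unfolded f₀ (rewind k p)) (t, x, v) := by
  have hq := mem_chordSet_of_mem_phaseSpace h hv
  have hx : ‖x‖ ≤ 1 := (mem_dataDomain_iff (q := (x, v))).1 h.1
  obtain ⟨k, -, hk⟩ := exists_char_eq_billiard hq hx ht
  have hs : freeMotion (t, x, v) ∈ chordSet := shift_mem_chordSet hq (-t)
  have hp : (t, x, v) ∈ timePhase := ⟨ht, h⟩
  have hk' : ‖(rewind k (t, x, v)).1‖ ≤ 1 := hk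
  -- After `k` reflections the coordinate `along - t |v| + 2kσ` is at most `σ`, while `along ≥ -σ`
  -- and `σ ≤ 1`.
  have hkσ : (k : ℝ) * halfChord (x, v) ≤ 1 + ‖v‖ * t := by
    have h1 := abs_le.1 ((norm_billiard_shift_le_one_iff hq k (-t)).1 hk)
    have h2 := abs_le.1 ((norm_fst_le_one_iff hq).1 hx)
    have h3 := halfChord_le_one (x, v)
    have h4 := mul_nonneg ht (norm_nonneg v)
    simp only [Int.cast_natCast] at h1
    linarith
  have hev : (fun p => unfolded f₀ (freeMotion p)) =ᶠ[nhds (t, x, v)]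
      fun p => unfolded f₀ (rewind k p) := by
    have hnhds : freeMotion ⁻¹' chordSet ∈ nhds (t, x, v) :=
      contDiff_freeMotion (n := 0).continuous.continuousAt.preimage_mem_nhds
        (isOpen_chordSet.mem_nhds hs)
    exact Filter.mem_of_superset hnhds fun p hp => (unfolded_billiard f₀ k hp).symm
  have hjet := jetBound_rewind (p := (t, x, v)) hq hx ht hkσ hk'
  refine ⟨k, hjet, billiard_mem_chordSet k hs, hk', fun j hj => ?_⟩
  rw [iteratedFDerivWithin_congr (eqOn_mildSol hf) hp,
    iteratedFDerivWithin_eq_iteratedFDeriv uniqueDiffOn_timePhase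
      ((contDiffAt_unfolded_freeMotion hU hp).of_le (by exact_mod_cast hj)) hp,
    (hev.iteratedFDeriv ℝ j).eq_of_nhds]

lemma hitSpeed_eq {x v : Plane} (h : (x, v) ∈ phaseSpace) (hv : v ≠ 0) :
    hitSpeed x v = ‖v‖ * halfChord (x, v) := by
  have hq := mem_chordSet_of_mem_phaseSpace h hv
  have hx : ‖x‖ ≤ 1 := (mem_dataDomain_iff (q := (x, v))).1 h.1
  have hρ : 0 < ‖v‖ := norm_pos_iff.2 hv
  have h1 := along_exit hq
  rw [along, div_eq_iff hρ.ne'] at h1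
  have h2 := exitPoint_eq hq hx
  simp only at h1 h2
  rw [hitSpeed, normal, real_inner_comm, h2, h1, abs_mul, abs_neg,
    abs_of_pos (halfChord_pos hq), abs_of_pos hρ, mul_comm]

/-- Since `hitSpeed = |v| σ`, the weight in the theorem is `growth` times `1 + |v|`; the factor `1 +
|v|` comes from differentiating in `t` and from rotating `v`. -/
lemma growth_mul_eq {t : ℝ} {x v : Plane} (h : (x, v) ∈ phaseSpace) (hv : v ≠ 0) :
    growth (t, x, v) * (1 + ‖v‖) =
      ‖v‖ / hitSpeed x v ^ 2 * japanese v ^ 2 * (1 + ‖v‖ * t) := by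
  have hρ : ‖v‖ ≠ 0 := norm_ne_zero_iff.2 hv
  have hσ := (halfChord_pos (mem_chordSet_of_mem_phaseSpace h hv)).ne'
  rw [hitSpeed_eq h hv, growth, japanese]
  field_simp
  ring

lemma one_le_growth_mul {t : ℝ} {x v : Plane} (ht : 0 ≤ t) (h : (x, v) ∈ phaseSpace)
    (hv : v ≠ 0) : 1 ≤ growth (t, x, v) * (1 + ‖v‖) :=
  one_le_mul_of_one_le_of_one_le
    (one_le_growth (p := (t, x, v)) (mem_chordSet_of_mem_phaseSpace h hv) ht)
    (by linarith [norm_nonneg v])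

lemma jetNorm_le_of_real {C : ℝ} (hC : 0 ≤ C) {p : ℝ × Plane × Plane} {q : Plane × Plane}
    {f : ℝ × Plane × Plane → ℝ} (hq : q ∈ dataDomain)
    (h : ∑ j ∈ Finset.range (n + 1), ‖iteratedFDerivWithin ℝ j f timePhase p‖ ≤
      C * ∑ j ∈ Finset.range (n + 1), ‖iteratedFDerivWithin ℝ j f₀ dataDomain q‖) :
    jetNorm n f timePhase p ≤ ENNReal.ofReal C * cNorm n f₀ dataDomain := by
  have h1 : jetNorm n f₀ dataDomain q ≤ cNorm n f₀ dataDomain :=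
    le_iSup₂ (f := fun p (_ : p ∈ dataDomain) => jetNorm n f₀ dataDomain p) q hq
  refine le_trans ?_ (mul_le_mul_right h1 _)
  rw [jetNorm_eq_ofReal, jetNorm_eq_ofReal, ← ENNReal.ofReal_mul hC]
  exact ENNReal.ofReal_le_ofReal h

lemma jetNorm_one_mildSol_le (hf : SpecularData f₀)
    (hU : ∀ q, q ∈ chordSet ∨ ‖q.1‖ < 1 → ContDiffAt ℝ (1 : ℕ) (unfolded f₀) q)
    {t : ℝ} {x v : Plane} (ht : 0 ≤ t) (h : (x, v) ∈ phaseSpace) (hv : v ≠ 0) :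
    jetNorm 1 (mildSol f₀) timePhase (t, x, v) ≤
      ENNReal.ofReal (28 * (growth (t, x, v) * (1 + ‖v‖))) * cNorm 1 f₀ dataDomain := by
  obtain ⟨k, ⟨a, hjet⟩, hc, hn, hder⟩ := exists_mildSol_jet hf hU ht h hv
  have hB := one_le_growth_mul ht h hv
  set B := growth (t, x, v) * (1 + ‖v‖)
  have hUq := hU _ (Or.inl hc)
  refine jetNorm_le_of_real (by positivity) (mem_dataDomain_iff.2 hn) ?_
  simp only [Finset.sum_range_succ, Finset.sum_range_zero, zero_add]
  rw [hder 0 (by norm_num), hder 1 le_rfl,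
    iteratedFDerivWithin_dataDomain_eq hf hc hn hUq (Nat.zero_le _),
    iteratedFDerivWithin_dataDomain_eq hf hc hn hUq le_rfl]
  simp only [norm_iteratedFDeriv_zero, norm_iteratedFDeriv_one]
  have h1 : ‖fderiv ℝ (fun p => unfolded f₀ (rewind k p)) (t, x, v)‖ ≤
      ‖fderiv ℝ (unfolded f₀) (rewind k (t, x, v))‖ * (28 * B) := by
    rw [fderiv_fun_comp _ (hUq.differentiableAt (by norm_num))
      (hjet.smooth.differentiableAt two_ne_zero)]
    exact (ContinuousLinearMap.opNorm_comp_le _ _).trans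
      (mul_le_mul_of_nonneg_left hjet.one (norm_nonneg _))
  nlinarith [norm_nonneg (unfolded f₀ (rewind k (t, x, v)))]

lemma jetNorm_two_mildSol_le (hf : SpecularData f₀)
    (hU : ∀ q, q ∈ chordSet ∨ ‖q.1‖ < 1 → ContDiffAt ℝ (2 : ℕ) (unfolded f₀) q)
    {t : ℝ} {x v : Plane} (ht : 0 ≤ t) (h : (x, v) ∈ phaseSpace) (hv : v ≠ 0) :
    jetNorm 2 (mildSol f₀) timePhase (t, x, v) ≤
      ENNReal.ofReal (1200 * (growth (t, x, v) * (1 + ‖v‖)) ^ 2) * cNorm 2 f₀ dataDomain := by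
  obtain ⟨k, ⟨a, hjet⟩, hc, hn, hder⟩ := exists_mildSol_jet hf hU ht h hv
  have hB := one_le_growth_mul ht h hv
  set B := growth (t, x, v) * (1 + ‖v‖)
  have hUq := hU _ (Or.inl hc)
  refine jetNorm_le_of_real (by positivity) (mem_dataDomain_iff.2 hn) ?_
  simp only [Finset.sum_range_succ, Finset.sum_range_zero, zero_add]
  rw [hder 0 (by norm_num), hder 1 (by norm_num), hder 2 le_rfl,
    iteratedFDerivWithin_dataDomain_eq hf hc hn hUq (Nat.zero_le _),
    iteratedFDerivWithin_dataDomain_eq hf hc hn hUq (by norm_num),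
    iteratedFDerivWithin_dataDomain_eq hf hc hn hUq le_rfl]
  have hcomp := JetBound.comp (g := unfolded f₀) ⟨hUq, le_rfl, le_rfl, le_rfl⟩ hjet
  simp only [norm_iteratedFDeriv_zero, norm_iteratedFDeriv_one]
  have h1 := hcomp.one
  have h2 := hcomp.two
  set y0 := ‖unfolded f₀ (rewind k (t, x, v))‖
  set y1 := ‖fderiv ℝ (unfolded f₀) (rewind k (t, x, v))‖
  set y2 := ‖iteratedFDeriv ℝ 2 (unfolded f₀) (rewind k (t, x, v))‖
  have n0 : 0 ≤ y0 := norm_nonneg _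
  have n1 : 0 ≤ y1 := norm_nonneg _
  have n2 : 0 ≤ y2 := norm_nonneg _
  have hB2 : B ≤ B ^ 2 := by nlinarith
  have e0 := mul_le_mul_of_nonneg_left (hB.trans hB2) n0
  have e1 := mul_le_mul_of_nonneg_left hB2 n1
  have e2 : 0 ≤ y0 * B ^ 2 := by positivity
  have e3 : 0 ≤ y1 * B ^ 2 := by positivity
  have e4 : 0 ≤ y2 * B ^ 2 := by positivity
  -- With `1 ≤ B ≤ B ^ 2`, the coefficients of `y0`, `y1`, `y2` are at most `1`, `28 + 332` and `28
  -- ^ 2` times `B ^ 2`, all below `1200 * B ^ 2`.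
  nlinarith

end solution

lemma AdmissibleC1.contDiffAt_unfolded {f₀ : Plane × Plane → ℝ} (hf : AdmissibleC1 f₀)
    (q : Plane × Plane) (hq : q ∈ chordSet ∨ ‖q.1‖ < 1) :
    ContDiffAt ℝ (1 : ℕ) (unfolded f₀) q := by
  rcases hq with hq | hq
  · exact contDiffAt_unfolded_of_exitStrip
      (contDiffOn_one_unfolded_exitStrip hf.contDiffOn hf.specular hf.compat) hq
  · exact contDiffAt_unfolded_of_norm_lt hf.contDiffOn hf.specular hq

lemma AdmissibleC2.contDiffAt_unfolded {f₀ : Plane × Plane → ℝ} (hf : AdmissibleC2 f₀)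
    (q : Plane × Plane) (hq : q ∈ chordSet ∨ ‖q.1‖ < 1) :
    ContDiffAt ℝ (2 : ℕ) (unfolded f₀) q := by
  rcases hq with hq | hq
  · exact contDiffAt_unfolded_of_exitStrip
      (contDiffOn_two_unfolded_exitStrip hf.contDiffOn hf.specular hf.compat hf.compatXX) hq
  · exact contDiffAt_unfolded_of_norm_lt hf.contDiffOn hf.specular hq

end DiskTransport

end

theorem theorem3 :
    (∃ C : ℝ, 0 < C ∧ ∀ f₀ : DiskTransport.Plane × DiskTransport.Plane → ℝ,
      DiskTransport.AdmissibleC1 f₀ →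
        DiskTransport.IsClassicalSol 1 f₀ (DiskTransport.mildSol f₀) ∧
        ∀ (t : ℝ) (x v : DiskTransport.Plane), 0 ≤ t → (x, v) ∈ DiskTransport.phaseSpace → v ≠ 0 →
          DiskTransport.jetNorm 1 (DiskTransport.mildSol f₀) DiskTransport.timePhase (t, x, v) ≤
            ENNReal.ofReal (C * (‖v‖ / DiskTransport.hitSpeed x v ^ 2
                * DiskTransport.japanese v ^ 2 * (1 + ‖v‖ * t)))
              * DiskTransport.cNorm 1 f₀ DiskTransport.dataDomain) ∧
    (∃ C : ℝ, 0 < C ∧ ∀ f₀ : DiskTransport.Plane × DiskTransport.Plane → ℝ,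
      DiskTransport.AdmissibleC2 f₀ →
        DiskTransport.IsClassicalSol 2 f₀ (DiskTransport.mildSol f₀) ∧
        ∀ (t : ℝ) (x v : DiskTransport.Plane), 0 ≤ t → (x, v) ∈ DiskTransport.phaseSpace → v ≠ 0 →
          DiskTransport.jetNorm 2 (DiskTransport.mildSol f₀) DiskTransport.timePhase (t, x, v) ≤
            ENNReal.ofReal (C * (‖v‖ ^ 2 / DiskTransport.hitSpeed x v ^ 4
                * DiskTransport.japanese v ^ 4 * (1 + ‖v‖ * t) ^ 2))
              * DiskTransport.cNorm 2 f₀ DiskTransport.dataDomain) := by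
  refine ⟨⟨28, by norm_num, fun f₀ hf => ⟨?_, fun t x v ht h hv => ?_⟩⟩,
    ⟨1200, by norm_num, fun f₀ hf => ⟨?_, fun t x v ht h hv => ?_⟩⟩⟩
  · exact DiskTransport.isClassicalSol_mildSol one_ne_zero hf.specular hf.contDiffAt_unfolded
  · rw [← DiskTransport.growth_mul_eq h hv]
    exact DiskTransport.jetNorm_one_mildSol_le hf.specular hf.contDiffAt_unfolded ht h hv
  · exact DiskTransport.isClassicalSol_mildSol two_ne_zero hf.specular hf.contDiffAt_unfolded
  · have heq : ‖v‖ ^ 2 / DiskTransport.hitSpeed x v ^ 4 * DiskTransport.japanese v ^ 4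
        * (1 + ‖v‖ * t) ^ 2 = (DiskTransport.growth (t, x, v) * (1 + ‖v‖)) ^ 2 := by
      rw [DiskTransport.growth_mul_eq h hv]; ring
    rw [heq]
    exact DiskTransport.jetNorm_two_mildSol_le hf.specular hf.contDiffAt_unfolded ht h hv
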